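/- Let $k$ be a field and let $Q=(Q_0,Q_1,s,t)$ be a finite quiver without oriented cycles whose underlying graph is one of the Euclidean diagrams $\tilde A_m$ ($m\ge 0$), $\tilde D_m$ ($m\ge 4$), $\tilde E_6,\tilde E_7,\tilde E_8$, with $n$ vertices. For $x,y\in\mathbb Z^{Q_0}$ let $\langle x,y\rangle=\sum_{i\in Q_0}x_iy_i-\sum_{\alpha\in Q_1}x_{s(\alpha)}y_{t(\alpha)}$ be the Euler form and $q(x)=\langle x,x\rangle$. A root is a non-zero $x\in\mathbb Z^{Q_0}$ with $q(x)\le 1$; it is positive if $x_i\ge 0$ for all $i$. Let $\delta\in\mathbb Z^{Q_0}$ be the standard positive generator of the radical of $q$, that is, the vector of the usual marks on the Euclidean diagram, and let $\partial x=\langle\delta,x\rangle$ be the defect of $x$. For a vertex $i$ let $P(i)$ and $I(i)$ be the representations of $Q$ over $k$ with $P(i)_j=k[Q(i,j)]$ and $I(i)_j=\operatorname{Hom}_k(k[Q(j,i)],k)$, where $Q(a,b)$ is the set of paths from $a$ to $b$ and $k[S]$ is the vector space with basis $S$; arrows act by composition of paths. An ordering $i_1,\dots,i_n$ of $Q_0$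 is admissible if, for each $p$, the vertex $i_p$ is a sink of $\sigma_{i_{p-1}}\cdots\sigma_{i_1}Q$, where $\sigma_i$ reverses all arrows at $i$; such orderings exist. Fix one, and let $C^+=S^+_{i_n}\cdots S^+_{i_1}$ and $C^-=S^-_{i_1}\cdots S^-_{i_n}$ be the Coxeter functors, where $S_i^{+}$ (for a sink $i$) and $S_i^-$ (for a source $i$) are the Bernstein--Gelfand--Ponomarev reflection functors. Put $C^r=(C^+)^r$ and $C^{-r}=(C^-)^{r}$ for $r\ge 0$. An indecomposable representation $X$ of $Q$ is called preprojective if $X\cong C^{-r}P(i)$, and preinjective if $X\cong C^{r}I(i)$, for some $i\in Q_0$ and some integer $r\ge 0$. Then the following hold. 1. The assignment $X\mapsto\dim X=(\dim_k X_i)_{i\in Q_0}$ induces a bijection between the isomorphism classes of (finite dimensional) indecomposable representations of $Q$ that are preprojective or preinjective and the positive roots $x$ with $\partial x\neq 0$. 2. The indecomposable preprojective and preinjective representations form $2n$ countably infinite series $C^{-r}P(i)$ and $C^rI(i)$ ($r\in\mathbb N_0$, $i\in Q_0$): all these representations are finite dimensional and indecomposable, they are pairwise non-isomorphic, and every indecomposable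 preprojective or preinjective representation is isomorphic to one of them. -/

import Mathlib

universe u

/-- A quiver `(Q₀, Q₁, s, t)` with set of vertices `V` and set of arrows `E`; both are
assumed finite where this matters. -/
@[ext]
structure FinQuiver (V E : Type) where
  src : E → V
  tgt : E → V

namespace FinQuiver

variable {V E : Type}

/-- The arrows `a ⟶ b`, as a quiver in the sense of Mathlib. -/
@[reducible]
def toQuiver (Q : FinQuiver V E) : Quiver V where
  Hom a b := {e : E // Q.src e = a ∧ Q.tgt e = b}

/-- The set `Q(a, b)` of paths from `a` to `b`, including the trivial path if `a = b`. -/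
abbrev Path (Q : FinQuiver V E) (a b : V) : Type := @Quiver.Path V Q.toQuiver a b

/-- The path `e ξ` obtained by prolonging a path `ξ` that ends at the source of `e`. -/
def Path.snoc (Q : FinQuiver V E) {a : V} (e : E) (p : Q.Path a (Q.src e)) :
    Q.Path a (Q.tgt e) :=
  @Quiver.Path.cons V Q.toQuiver a (Q.src e) (Q.tgt e) p ⟨e, rfl, rfl⟩

/-- The path `ξ e` obtained by preceding a path `ξ` that starts at the target of `e`. -/
def Path.precede (Q : FinQuiver V E) {b : V} (e : E) (p : Q.Path (Q.tgt e) b) :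
    Q.Path (Q.src e) b :=
  @Quiver.Path.comp V Q.toQuiver (Q.src e) (Q.tgt e) b
    (@Quiver.Hom.toPath V Q.toQuiver (Q.src e) (Q.tgt e) ⟨e, rfl, rfl⟩) p

/-- There are no oriented cycles: every path from a vertex to itself is trivial. -/
def NoOrientedCycles (Q : FinQuiver V E) : Prop :=
  ∀ (a : V) (p : Q.Path a a), p = @Quiver.Path.nil V Q.toQuiver a

/-- No arrow starts at `i`. -/
def IsSink (Q : FinQuiver V E) (i : V) : Prop := ∀ e, Q.src e ≠ i

/-- The quiver `σ_i Q`: all arrows which start or end at `i` are reversed. -/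
def reflect [DecidableEq V] (Q : FinQuiver V E) (i : V) : FinQuiver V E where
  src e := if Q.src e = i ∨ Q.tgt e = i then Q.tgt e else Q.src e
  tgt e := if Q.src e = i ∨ Q.tgt e = i then Q.src e else Q.tgt e

/-- `reflectList Q [i₁, …, i_p] = σ_{i_p} ⋯ σ_{i₁} Q`. -/
def reflectList [DecidableEq V] (Q : FinQuiver V E) : List V → FinQuiver V E
  | [] => Q
  | i :: l => reflectList (Q.reflect i) l

/-- For each `p`, the vertex `i_p` is a sink of `σ_{i_{p-1}} ⋯ σ_{i₁} Q`. -/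
def SinkSequence [DecidableEq V] (Q : FinQuiver V E) : List V → Prop
  | [] => True
  | i :: l => Q.IsSink i ∧ SinkSequence (Q.reflect i) l

/-- An admissible ordering of the vertices of `Q`. -/
structure AdmissibleOrdering [DecidableEq V] (Q : FinQuiver V E) where
  list : List V
  nodup : list.Nodup
  mem : ∀ v, v ∈ list
  sinks : Q.SinkSequence list

theorem reflectList_ends [DecidableEq V] (Q : FinQuiver V E) (l : List V) (e : E) :
    ((Q.reflectList l).src e =
      if Even (l.count (Q.src e) + l.count (Q.tgt e)) then Q.src e else Q.tgt e) ∧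
    ((Q.reflectList l).tgt e =
      if Even (l.count (Q.src e) + l.count (Q.tgt e)) then Q.tgt e else Q.src e) := by
  induction l generalizing Q with
  | nil => simp [reflectList]
  | cons i l ih =>
    obtain ⟨h1, h2⟩ := ih (Q.reflect i)
    simp only [reflectList]
    rw [h1, h2]
    by_cases hs : Q.src e = i <;> by_cases ht : Q.tgt e = i
    · simp [reflect, hs, ht]
    · have ht' : ¬ i = Q.tgt e := fun h => ht h.symm
      have hc : Even ((i :: l).count i + (i :: l).count (Q.tgt e)) ↔
          ¬ Even (l.count (Q.tgt e) + l.count i) := by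
        rw [List.count_cons_self, List.count_cons_of_ne ht', add_right_comm,
          Nat.even_add_one, add_comm]
      simp only [reflect, hs, ht, or_false, if_true, hc]
      split_ifs <;> simp_all
    · have hs' : ¬ i = Q.src e := fun h => hs h.symm
      have hc : Even ((i :: l).count (Q.src e) + (i :: l).count i) ↔
          ¬ Even (l.count i + l.count (Q.src e)) := by
        rw [List.count_cons_self, List.count_cons_of_ne hs', ← add_assoc,
          Nat.even_add_one, add_comm]
      simp only [reflect, hs, ht, or_true, if_true, hc]
      split_ifs <;> simp_all
    · have ht' : ¬ i = Q.tgt e := fun h => ht h.symm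
      have hs' : ¬ i = Q.src e := fun h => hs h.symm
      simp [reflect, hs, ht, List.count_cons_of_ne hs', List.count_cons_of_ne ht']

/-- Reflecting once at every vertex reverses every arrow twice. -/
theorem reflectList_eq_self [DecidableEq V] (Q : FinQuiver V E) (l : List V)
    (hl : l.Nodup) (hm : ∀ v, v ∈ l) : Q.reflectList l = Q := by
  have h : ∀ e, Even (l.count (Q.src e) + l.count (Q.tgt e)) := fun e => by
    rw [List.count_eq_one_of_mem hl (hm _), List.count_eq_one_of_mem hl (hm _)]
    decide
  ext e
  · rw [(Q.reflectList_ends l e).1, if_pos (h e)]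
  · rw [(Q.reflectList_ends l e).2, if_pos (h e)]

/-- The Euler form `⟨x, y⟩`. -/
def eulerForm [Fintype V] [Fintype E] (Q : FinQuiver V E) (x y : V → ℤ) : ℤ :=
  ∑ i, x i * y i - ∑ e, x (Q.src e) * y (Q.tgt e)

/-- The quadratic form `q(x) = ½ (x, x) = ⟨x, x⟩` of the underlying graph. -/
def quadForm [Fintype V] [Fintype E] (Q : FinQuiver V E) (x : V → ℤ) : ℤ :=
  Q.eulerForm x x

/-- Roots: the non-zero integral vectors `x` with `q(x) ≤ 1`. -/
def IsRoot [Fintype V] [Fintype E] (Q : FinQuiver V E) (x : V → ℤ) : Prop :=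
  x ≠ 0 ∧ Q.quadForm x ≤ 1

end FinQuiver

/-- The Euclidean diagrams `Ã_m` (`m ≥ 0`), `D̃_m` (`m ≥ 4`), `Ẽ₆`, `Ẽ₇`, `Ẽ₈`. -/
inductive EuclideanDiagram : Type
  | A (m : ℕ) : EuclideanDiagram
  | D (m : ℕ) (hm : 4 ≤ m) : EuclideanDiagram
  | E6 : EuclideanDiagram
  | E7 : EuclideanDiagram
  | E8 : EuclideanDiagram

namespace EuclideanDiagram

/-- The number `n = m + 1` of vertices; the vertices are `0, …, n - 1`. -/
def card : EuclideanDiagram → ℕ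
  | A m => m + 1
  | D m _ => m + 1
  | E6 => 7
  | E7 => 8
  | E8 => 9

/-- The edges. `Ã_m` is a cycle with `m + 1` edges (a loop for `m = 0`, a double edge for
`m = 1`). `D̃_m` is the path `1, …, m - 1` with `0` attached to `2` and `m` attached to
`m - 2`. -/
def edges : EuclideanDiagram → List (ℕ × ℕ)
  | A m => (List.range (m + 1)).map fun i => (i, (i + 1) % (m + 1))
  | D m _ => (0, 2) :: (m - 2, m) :: (List.range (m - 2)).map fun i => (i + 1, i + 2)
  | E6 => [(0, 1), (1, 2), (2, 3), (3, 4), (2, 5), (5, 6)]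
  | E7 => [(0, 1), (1, 2), (2, 3), (3, 4), (4, 5), (5, 6), (3, 7)]
  | E8 => [(0, 1), (1, 2), (2, 3), (3, 4), (4, 5), (5, 6), (6, 7), (2, 8)]

/-- The marks `δ_i` of the vertices. -/
def delta : EuclideanDiagram → ℕ → ℤ
  | A _, _ => 1
  | D m _, v => if v = 0 ∨ v = 1 ∨ v = m - 1 ∨ v = m then 1 else 2
  | E6, v => [1, 2, 3, 2, 1, 2, 1].getD v 0
  | E7, v => [1, 2, 3, 4, 3, 2, 1, 2].getD v 0
  | E8, v => [2, 4, 6, 5, 4, 3, 2, 1, 3].getD v 0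

end EuclideanDiagram

namespace FinQuiver

variable {V E : Type}

/-- The bijection `f` of vertices identifies the underlying graph of `Q`, with its edges
counted with multiplicity, with the Euclidean diagram `T`. -/
def HasDiagram [Fintype E] (Q : FinQuiver V E) (T : EuclideanDiagram)
    (f : V ≃ Fin T.card) : Prop :=
  (Finset.univ : Finset E).val.map (fun e => s((f (Q.src e) : ℕ), (f (Q.tgt e) : ℕ))) =
    ((T.edges.map fun p => s(p.1, p.2) : List (Sym2 ℕ)) : Multiset (Sym2 ℕ))

/-- The defect `∂x = ⟨δ, x⟩`, where `δ` is transported to the vertices of `Q` along `f`. -/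
def defect [Fintype V] [Fintype E] (Q : FinQuiver V E) (T : EuclideanDiagram)
    (f : V ≃ Fin T.card) (x : V → ℤ) : ℤ :=
  Q.eulerForm (fun i => T.delta (f i : ℕ)) x

end FinQuiver

/-- The type `B` if the proposition `P` holds, and `A` otherwise. -/
def Pick {P : Prop} (d : Decidable P) (B A : Type u) : Type u :=
  match d with
  | isTrue _ => B
  | isFalse _ => A

namespace Pick

variable {P : Prop} (d : Decidable P) (B A : Type u)

instance addCommGroup [AddCommGroup B] [AddCommGroup A] : AddCommGroup (Pick d B A) :=
  match d with
  | isTrue _ => inferInstanceAs (AddCommGroup B)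
  | isFalse _ => inferInstanceAs (AddCommGroup A)

variable (k : Type u) [Field k]

instance module [AddCommGroup B] [AddCommGroup A] [Module k B] [Module k A] :
    Module k (Pick d B A) :=
  match d with
  | isTrue _ => inferInstanceAs (Module k B)
  | isFalse _ => inferInstanceAs (Module k A)

variable {B A} [AddCommGroup B] [AddCommGroup A] [Module k B] [Module k A]

/-- The identity, if `P` holds. -/
def posEquiv (h : P) : Pick d B A ≃ₗ[k] B :=
  match d with
  | isTrue _ => LinearEquiv.refl k B
  | isFalse h' => absurd h h'

/-- The identity, if `P` does not hold. -/
def negEquiv (h : ¬ P) : Pick d B A ≃ₗ[k] A :=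
  match d with
  | isTrue h' => absurd h' h
  | isFalse _ => LinearEquiv.refl k A

end Pick

/-- A representation over `k` of the quiver `Q` (not necessarily finite dimensional). -/
structure QuiverRep {V E : Type} (k : Type u) [Field k] (Q : FinQuiver V E) where
  obj : V → Type u
  [addCommGroup : ∀ i, AddCommGroup (obj i)]
  [module : ∀ i, Module k (obj i)]
  map : ∀ e, obj (Q.src e) →ₗ[k] obj (Q.tgt e)

attribute [instance] QuiverRep.addCommGroup QuiverRep.module

namespace QuiverRep

variable {V E : Type} {k : Type u} [Field k] {Q : FinQuiver V E}

/-- Isomorphisms of representations. -/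
structure Iso (X Y : QuiverRep k Q) where
  equiv : ∀ i, X.obj i ≃ₗ[k] Y.obj i
  comm : ∀ e x, Y.map e (equiv (Q.src e) x) = equiv (Q.tgt e) (X.map e x)

/-- `X ≅ Y`. -/
def IsIsomorphic (X Y : QuiverRep k Q) : Prop := Nonempty (Iso X Y)

theorem isIsomorphic_equivalence :
    Equivalence (IsIsomorphic : QuiverRep k Q → QuiverRep k Q → Prop) where
  refl X := ⟨⟨fun i => LinearEquiv.refl k (X.obj i), fun _ _ => rfl⟩⟩
  symm := by
    rintro X Y ⟨f⟩
    refine ⟨⟨fun i => (f.equiv i).symm, fun e y => ?_⟩⟩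
    rw [LinearEquiv.eq_symm_apply, ← f.comm, LinearEquiv.apply_symm_apply]
  trans := by
    rintro X Y Z ⟨f⟩ ⟨g⟩
    refine ⟨⟨fun i => (f.equiv i).trans (g.equiv i), fun e x => ?_⟩⟩
    simp only [LinearEquiv.trans_apply, g.comm, f.comm]

variable (k Q) in
/-- Representations up to isomorphism. -/
def isoSetoid : Setoid (QuiverRep k Q) := ⟨IsIsomorphic, isIsomorphic_equivalence⟩

variable (k Q) in
/-- Isomorphism classes of representations. -/
def IsoClass : Type (u + 1) := Quotient (isoSetoid k Q)

/-- The isomorphism class of a representation. -/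
def isoClass (X : QuiverRep k Q) : IsoClass k Q := Quotient.mk (isoSetoid k Q) X

/-- Each of the vector spaces `X_i` is finite dimensional. -/
def IsFiniteDimensional (X : QuiverRep k Q) : Prop := ∀ i, FiniteDimensional k (X.obj i)

/-- The dimension vector (meaningful for finite dimensional representations). -/
noncomputable def dimVector (X : QuiverRep k Q) : V → ℤ :=
  fun i => (Module.finrank k (X.obj i) : ℤ)

/-- The dimension vector of an isomorphism class. -/
noncomputable def IsoClass.dimVector : IsoClass k Q → V → ℤ :=
  Quotient.lift QuiverRep.dimVector (by
    rintro X Y ⟨f⟩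
    funext i
    exact congrArg Nat.cast (f.equiv i).finrank_eq)

/-- A family of subspaces `U_i` of `X_i` is a subrepresentation of `X`. -/
def IsSubrep (X : QuiverRep k Q) (U : ∀ i, Submodule k (X.obj i)) : Prop :=
  ∀ e, ∀ x ∈ U (Q.src e), X.map e x ∈ U (Q.tgt e)

/-- `X ≠ 0`, and `X = U ⊕ W` implies `U = 0` or `W = 0`. -/
def Indecomposable (X : QuiverRep k Q) : Prop :=
  (∃ i, Nontrivial (X.obj i)) ∧
    ∀ U W : ∀ i, Submodule k (X.obj i), X.IsSubrep U → X.IsSubrep W →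
      (∀ i, IsCompl (U i) (W i)) → (∀ i, U i = ⊥) ∨ (∀ i, W i = ⊥)

variable (k Q) in
/-- The projective representation `P(i)`, with `P(i)_j = k[Q(i, j)]`. -/
noncomputable def proj (i : V) : QuiverRep k Q where
  obj j := Q.Path i j →₀ k
  map e := Finsupp.lmapDomain k k (FinQuiver.Path.snoc Q e)

variable (k Q) in
/-- The injective representation `I(i)`, with `I(i)_j = D k[Q(j, i)]`. -/
noncomputable def inj (i : V) : QuiverRep k Q where
  obj j := Module.Dual k (Q.Path j i →₀ k)
  map e := (Finsupp.lmapDomain k k (FinQuiver.Path.precede Q (b := i) e)).dualMap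

/-- The identity of `X_i`, for two names `i`, `j` of the same vertex. -/
def castObj (X : QuiverRep k Q) {i j : V} (h : i = j) : X.obj i ≃ₗ[k] X.obj j :=
  h ▸ LinearEquiv.refl k (X.obj i)

/-- The map `⨁_{t(α) = i} X_{s(α)} ⟶ X_i` given by the `X_α`. -/
def inMap [DecidableEq V] [Fintype E] (X : QuiverRep k Q) (i : V) :
    ((e : {e : E // Q.tgt e = i}) → X.obj (Q.src e)) →ₗ[k] X.obj i :=
  ∑ e : {e : E // Q.tgt e = i},
    (X.castObj e.2).toLinearMap ∘ₗ X.map e ∘ₗ LinearMap.proj e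

/-- The map `X_i ⟶ ⨁_{s(α) = i} X_{t(α)}` given by the `X_α`. -/
def outMap (X : QuiverRep k Q) (i : V) :
    X.obj i →ₗ[k] ((e : {e : E // Q.src e = i}) → X.obj (Q.tgt e)) :=
  LinearMap.pi fun e => X.map e ∘ₗ (X.castObj e.2.symm).toLinearMap

/-- The underlying spaces of `S_i^+ X`: the kernel of `inMap` at `i`, and `X_j` for
`j ≠ i`. -/
abbrev plusObj [DecidableEq V] [Fintype E] (X : QuiverRep k Q) (i j : V) : Type u :=
  Pick (decEq j i) (LinearMap.ker (X.inMap i)) (X.obj j)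

/-- The representation `S_i^+ X` of `σ_i Q`, for a sink `i` of `Q`. An arrow `α` with
`t(α) = i` acts by the inclusion of the kernel followed by the projection onto `X_{s(α)}`;
the other arrows act as on `X`. (For arrows starting at `i`, which do not exist if `i` is
a sink, the map is set to be `0`.) -/
def reflPlus [DecidableEq V] [Fintype E] (X : QuiverRep k Q) (i : V) :
    QuiverRep k (Q.reflect i) where
  obj j := X.plusObj i j
  map e :=
    if hs : Q.src e = i then 0
    else if ht : Q.tgt e = i then
      have h1 : (Q.reflect i).src e = i := by simp [FinQuiver.reflect, ht]
      have h2 : (Q.reflect i).tgt e = Q.src e := by simp [FinQuiver.reflect, ht]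
      (Pick.negEquiv _ k (h2.trans_ne hs)).symm.toLinearMap ∘ₗ
        (X.castObj h2.symm).toLinearMap ∘ₗ
        LinearMap.proj (⟨e, ht⟩ : {e : E // Q.tgt e = i}) ∘ₗ
        (LinearMap.ker (X.inMap i)).subtype ∘ₗ
        (Pick.posEquiv _ k h1).toLinearMap
    else
      have h1 : (Q.reflect i).src e = Q.src e := by simp [FinQuiver.reflect, hs, ht]
      have h2 : (Q.reflect i).tgt e = Q.tgt e := by simp [FinQuiver.reflect, hs, ht]
      (Pick.negEquiv _ k (h2.trans_ne ht)).symm.toLinearMap ∘ₗ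
        (X.castObj h2.symm).toLinearMap ∘ₗ X.map e ∘ₗ (X.castObj h1).toLinearMap ∘ₗ
        (Pick.negEquiv _ k (h1.trans_ne hs)).toLinearMap

/-- The underlying spaces of `S_i^- X`: the cokernel of `outMap` at `i`, and `X_j` for
`j ≠ i`. -/
abbrev minusObj [DecidableEq V] (X : QuiverRep k Q) (i j : V) : Type u :=
  Pick (decEq j i)
    (((e : {e : E // Q.src e = i}) → X.obj (Q.tgt e)) ⧸ LinearMap.range (X.outMap i))
    (X.obj j)

/-- The representation `S_i^- X` of `σ_i Q`, for a source `i` of `Q`. An arrow `α` with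
`s(α) = i` acts by the inclusion of `X_{t(α)}` into the direct sum followed by the canonical
map onto the cokernel; the other arrows act as on `X`. (For arrows ending at `i`, which do
not exist if `i` is a source, the map is set to be `0`.) -/
def reflMinus [DecidableEq V] [DecidableEq E] (X : QuiverRep k Q) (i : V) :
    QuiverRep k (Q.reflect i) where
  obj j := X.minusObj i j
  map e :=
    if ht : Q.tgt e = i then 0
    else if hs : Q.src e = i then
      have h1 : (Q.reflect i).src e = Q.tgt e := by simp [FinQuiver.reflect, hs]
      have h2 : (Q.reflect i).tgt e = i := by simp [FinQuiver.reflect, hs]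
      (Pick.posEquiv _ k h2).symm.toLinearMap ∘ₗ
        (LinearMap.range (X.outMap i)).mkQ ∘ₗ
        LinearMap.single k (fun e : {e : E // Q.src e = i} => X.obj (Q.tgt e)) ⟨e, hs⟩ ∘ₗ
        (X.castObj h1).toLinearMap ∘ₗ
        (Pick.negEquiv _ k (h1.trans_ne ht)).toLinearMap
    else
      have h1 : (Q.reflect i).src e = Q.src e := by simp [FinQuiver.reflect, hs, ht]
      have h2 : (Q.reflect i).tgt e = Q.tgt e := by simp [FinQuiver.reflect, hs, ht]
      (Pick.negEquiv _ k (h2.trans_ne ht)).symm.toLinearMap ∘ₗ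
        (X.castObj h2.symm).toLinearMap ∘ₗ X.map e ∘ₗ (X.castObj h1).toLinearMap ∘ₗ
        (Pick.negEquiv _ k (h1.trans_ne hs)).toLinearMap

variable [DecidableEq V] [Fintype E] [DecidableEq E]

/-- `S_{i_p}^+ ⋯ S_{i₁}^+ X` for the list `[i₁, …, i_p]`. -/
def plusList {Q : FinQuiver V E} (X : QuiverRep k Q) :
    (l : List V) → QuiverRep k (Q.reflectList l)
  | [] => X
  | i :: l => plusList (X.reflPlus i) l

/-- `S_{i_p}^- ⋯ S_{i₁}^- X` for the list `[i₁, …, i_p]`. -/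
def minusList {Q : FinQuiver V E} (X : QuiverRep k Q) :
    (l : List V) → QuiverRep k (Q.reflectList l)
  | [] => X
  | i :: l => minusList (X.reflMinus i) l

/-- A representation of `Q`, regarded as a representation of the equal quiver `Q'`. -/
def castQuiver {Q Q' : FinQuiver V E} (h : Q = Q') (X : QuiverRep k Q) : QuiverRep k Q' :=
  h ▸ X

/-- The Coxeter functor `C^+ = S_{i_n}^+ ⋯ S_{i₁}^+` on objects. -/
def coxPlus (o : Q.AdmissibleOrdering) (X : QuiverRep k Q) : QuiverRep k Q :=
  castQuiver (Q.reflectList_eq_self o.list o.nodup o.mem) (X.plusList o.list)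

/-- The Coxeter functor `C^- = S_{i₁}^- ⋯ S_{i_n}^-` on objects. -/
def coxMinus (o : Q.AdmissibleOrdering) (X : QuiverRep k Q) : QuiverRep k Q :=
  castQuiver
    (Q.reflectList_eq_self o.list.reverse (List.nodup_reverse.2 o.nodup)
      fun v => List.mem_reverse.2 (o.mem v))
    (X.minusList o.list.reverse)

/-- `C^r X` for an integer `r`: this is `(C^+)^r X` for `r ≥ 0` and `(C^-)^{-r} X` for
`r < 0`. -/
def coxPow (o : Q.AdmissibleOrdering) : ℤ → QuiverRep k Q → QuiverRep k Q
  | Int.ofNat r, X => (coxPlus o)^[r] X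
  | Int.negSucc r, X => (coxMinus o)^[r + 1] X

/-- `X` is indecomposable and `X ≅ C^r P(i)` for some vertex `i` and some `r ≤ 0`. -/
def IsPreprojective (o : Q.AdmissibleOrdering) (X : QuiverRep k Q) : Prop :=
  X.Indecomposable ∧ ∃ (i : V) (r : ℤ), r ≤ 0 ∧ X.IsIsomorphic (coxPow o r (proj k Q i))

/-- `X` is indecomposable and `X ≅ C^r I(i)` for some vertex `i` and some `r ≥ 0`. -/
def IsPreinjective (o : Q.AdmissibleOrdering) (X : QuiverRep k Q) : Prop :=
  X.Indecomposable ∧ ∃ (i : V) (r : ℤ), 0 ≤ r ∧ X.IsIsomorphic (coxPow o r (inj k Q i))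

variable (k) in
/-- The isomorphism classes of finite dimensional indecomposable representations which are
preprojective or preinjective. -/
def preprojPreinjClasses (o : Q.AdmissibleOrdering) : Set (IsoClass k Q) :=
  {c | ∃ X : QuiverRep k Q, X.isoClass = c ∧ X.IsFiniteDimensional ∧
    (IsPreprojective o X ∨ IsPreinjective o X)}

variable (k) in
/-- The series `C^{-r} P(i)` (`r ≥ 0`) for each `i` in the left copy of the set of vertices
and `C^r I(i)` (`r ≥ 0`) for each `i` in the right copy. -/
noncomputable def series (o : Q.AdmissibleOrdering) : V ⊕ V → ℕ → QuiverRep k Q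
  | Sum.inl i, r => coxPow o (-(r : ℤ)) (proj k Q i)
  | Sum.inr i, r => coxPow o (r : ℤ) (inj k Q i)

end QuiverRep

/-!
A reflection functor acts on the dimension vector of an indecomposable representation as the simple
reflection at the vertex, unless that vector is the simple root there. Hence Coxeter functors act on
indecomposables as the Coxeter transformation `c` and its inverse, as long as no simple root is met,
and a positive root meets a simple root on its way through `c` exactly when it is some `dim P(i)`.
Moreover `c (dim P(i)) = -dim I(i)`, and `c` preserves the defect, which is negative on `dim P(i)`
and positive on `dim I(i)`; so the roots `c⁻ʳ (dim P(i))` and `cʳ (dim I(i))` are positive and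
pairwise distinct.

It remains to see that a positive root `x` of negative defect is some `c⁻ʳ (dim P(i))`; positive
defect follows by passing to the opposite quiver. Modulo `δ` the orbit of `x` under `c` is finite,
so some `c ^ m` translates `x` by a multiple `t δ`. Then `c` itself translates the sum `y` of
`x, c x, …, c ^ (m - 1) x` by `t δ`, and `2 q(y) = t ∂y`. Here `q(y) > 0 > ∂y`, so `t < 0` and the
vectors `cʳ x` cannot all be positive: the orbit meets some `dim P(i)`.
-/

/-! ### Reflections and Coxeter transformations -/

namespace FinQuiver

variable {V E : Type}

/-- The opposite quiver. It turns sinks into sources, hence is used to deduce statements about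
injective representations from statements about projective ones. -/
def op (Q : FinQuiver V E) : FinQuiver V E := ⟨Q.tgt, Q.src⟩

/-- There is no arrow from a vertex to itself. -/
def Loopless (Q : FinQuiver V E) : Prop := ∀ e, Q.src e ≠ Q.tgt e

/-- The vertex `i` is a source: no arrow ends there. -/
def IsSource (Q : FinQuiver V E) (i : V) : Prop := ∀ e, Q.tgt e ≠ i

section Reflect

variable [DecidableEq V]

theorem op_reflect (Q : FinQuiver V E) (i : V) : Q.op.reflect i = (Q.reflect i).op := by
  ext e <;> simp only [op, reflect, or_comm]

theorem op_reflectList (Q : FinQuiver V E) (l : List V) :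
    Q.op.reflectList l = (Q.reflectList l).op := by
  induction l generalizing Q with
  | nil => rfl
  | cons i l ih => simp only [reflectList, op_reflect, ih]

theorem reflect_reflect (Q : FinQuiver V E) (i : V) : (Q.reflect i).reflect i = Q := by
  ext e <;> simp only [reflect] <;> split_ifs <;> simp_all

theorem reflectList_append (Q : FinQuiver V E) (l₁ l₂ : List V) :
    Q.reflectList (l₁ ++ l₂) = (Q.reflectList l₁).reflectList l₂ := by
  induction l₁ generalizing Q with
  | nil => rfl
  | cons i _ ih => exact ih (Q.reflect i)

theorem reflectList_reverse (Q : FinQuiver V E) (l : List V) :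
    (Q.reflectList l).reflectList l.reverse = Q := by
  induction l generalizing Q with
  | nil => rfl
  | cons i l ih =>
    rw [List.reverse_cons, reflectList_append]
    simp only [reflectList]
    rw [ih, reflect_reflect]

theorem sinkSequence_append (Q : FinQuiver V E) (l₁ l₂ : List V) :
    Q.SinkSequence (l₁ ++ l₂) ↔ Q.SinkSequence l₁ ∧ (Q.reflectList l₁).SinkSequence l₂ := by
  induction l₁ generalizing Q with
  | nil => simp [SinkSequence, reflectList]
  | cons i l ih => simp [SinkSequence, reflectList, ih, and_assoc]

theorem IsSink.op_reflect {Q : FinQuiver V E} {i : V} (hi : Q.IsSink i) :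
    (Q.reflect i).op.IsSink i := by
  intro e
  have := hi e
  simp only [op, reflect]
  split_ifs <;> simp_all

theorem SinkSequence.op_reverse {Q : FinQuiver V E} {l : List V} (hl : Q.SinkSequence l) :
    (Q.reflectList l).op.SinkSequence l.reverse := by
  induction l generalizing Q with
  | nil => trivial
  | cons i l ih =>
    rw [List.reverse_cons, sinkSequence_append, op_reflectList]
    refine ⟨ih hl.2, ?_, trivial⟩
    simp only [reflectList]
    rw [reflectList_reverse]
    exact hl.1.op_reflect

namespace AdmissibleOrdering

variable {Q : FinQuiver V E} (o : Q.AdmissibleOrdering)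

/-- The reversed ordering, which is admissible for the opposite quiver. It interchanges the
roles of the Coxeter transformation and its inverse. -/
def op : Q.op.AdmissibleOrdering where
  list := o.list.reverse
  nodup := List.nodup_reverse.2 o.nodup
  mem v := List.mem_reverse.2 (o.mem v)
  sinks := by
    have h := o.sinks.op_reverse
    rwa [Q.reflectList_eq_self o.list o.nodup o.mem] at h

theorem notMem_of_list_eq {l₁ l₂ : List V} {i : V} (hl : o.list = l₁ ++ i :: l₂) : i ∉ l₁ :=
  fun hi => (List.nodup_append.1 (hl ▸ o.nodup)).2.2 i hi i List.mem_cons_self rfl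

end AdmissibleOrdering

-- A loop survives all reflections, so its vertex never becomes a sink.
theorem AdmissibleOrdering.loopless {Q : FinQuiver V E} (o : Q.AdmissibleOrdering) :
    Q.Loopless := by
  intro e he
  obtain ⟨l₁, l₂, hl⟩ := List.append_of_mem (o.mem (Q.src e))
  have hsinks : Q.SinkSequence (l₁ ++ Q.src e :: l₂) := hl ▸ o.sinks
  refine ((sinkSequence_append Q _ _).1 hsinks).2.1 e ?_
  rw [(Q.reflectList_ends l₁ e).1, ← he, ite_self]

end Reflect

section Forms

variable [Fintype V] [Fintype E]

/-- The Euler form as a bilinear form. -/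
def eulerBilin (Q : FinQuiver V E) : LinearMap.BilinForm ℤ (V → ℤ) :=
  LinearMap.mk₂ ℤ Q.eulerForm
    (fun x x' y => by
      simp only [eulerForm, Pi.add_apply, add_mul, Finset.sum_add_distrib]; ring)
    (fun a x y => by
      simp only [eulerForm, Pi.smul_apply, smul_eq_mul, mul_assoc, ← Finset.mul_sum]; ring)
    (fun x y y' => by
      simp only [eulerForm, Pi.add_apply, mul_add, Finset.sum_add_distrib]; ring)
    (fun a x y => by
      simp only [eulerForm, Pi.smul_apply, smul_eq_mul, mul_left_comm _ a, ← Finset.mul_sum]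
      ring)

@[simp]
theorem eulerBilin_apply (Q : FinQuiver V E) (x y : V → ℤ) :
    Q.eulerBilin x y = Q.eulerForm x y := rfl

/-- The symmetric bilinear form `(x, y) = ⟨x, y⟩ + ⟨y, x⟩`, which depends only on the underlying
graph. -/
def symmForm (Q : FinQuiver V E) : LinearMap.BilinForm ℤ (V → ℤ) :=
  Q.eulerBilin + Q.eulerBilin.flip

theorem symmForm_eq_add (Q : FinQuiver V E) (x y : V → ℤ) :
    Q.symmForm x y = Q.eulerForm x y + Q.eulerForm y x := rfl

theorem symmForm_comm (Q : FinQuiver V E) (x y : V → ℤ) : Q.symmForm x y = Q.symmForm y x :=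
  add_comm _ _

theorem symmForm_self (Q : FinQuiver V E) (x : V → ℤ) : Q.symmForm x x = 2 * Q.quadForm x :=
  (two_mul _).symm

theorem symmForm_eq_sub (Q : FinQuiver V E) (x y : V → ℤ) :
    Q.symmForm x y =
      2 * ∑ i, x i * y i - ∑ e, (x (Q.src e) * y (Q.tgt e) + x (Q.tgt e) * y (Q.src e)) := by
  simp only [symmForm_eq_add, eulerForm, Finset.sum_add_distrib, mul_comm (y _)]
  ring

theorem eulerForm_op (Q : FinQuiver V E) (x y : V → ℤ) :
    Q.op.eulerForm x y = Q.eulerForm y x := by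
  simp only [eulerForm, op, mul_comm]

theorem quadForm_op (Q : FinQuiver V E) : Q.op.quadForm = Q.quadForm :=
  funext fun x => Q.eulerForm_op x x

theorem symmForm_op (Q : FinQuiver V E) : Q.op.symmForm = Q.symmForm := by
  ext x y
  simp [symmForm_eq_add, eulerForm_op, add_comm]

theorem quadForm_add (Q : FinQuiver V E) (x y : V → ℤ) :
    Q.quadForm (x + y) = Q.quadForm x + Q.quadForm y + Q.symmForm x y := by
  simp only [quadForm, symmForm_eq_add, ← eulerBilin_apply, map_add, LinearMap.add_apply]
  ring

theorem quadForm_neg (Q : FinQuiver V E) (x : V → ℤ) : Q.quadForm (-x) = Q.quadForm x := by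
  simp only [quadForm, ← eulerBilin_apply, map_neg, LinearMap.neg_apply, neg_neg]

variable [DecidableEq V]

theorem symmForm_reflect (Q : FinQuiver V E) (i : V) :
    (Q.reflect i).symmForm = Q.symmForm := by
  refine LinearMap.ext₂ fun x y => ?_
  simp only [symmForm_eq_sub]
  congr 1
  refine Finset.sum_congr rfl fun e _ => ?_
  simp only [reflect]
  split_ifs
  · exact add_comm _ _
  · rfl

theorem eulerForm_eq_sum (Q : FinQuiver V E) (x y : V → ℤ) :
    Q.eulerForm x y = ∑ i, Q.eulerForm x (Pi.single i 1) * y i := by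
  conv_lhs => rw [pi_eq_sum_univ' y, ← eulerBilin_apply, map_sum]
  refine Finset.sum_congr rfl fun i _ => ?_
  rw [map_smul, smul_eq_mul, mul_comm, eulerBilin_apply]

theorem symmForm_single (Q : FinQuiver V E) (i : V) (x : V → ℤ) :
    Q.symmForm (Pi.single i 1) x =
      2 * x i - ∑ e, ((if Q.src e = i then x (Q.tgt e) else 0) +
        if Q.tgt e = i then x (Q.src e) else 0) := by
  simp [symmForm_eq_sub, Pi.single_apply]

theorem Loopless.quadForm_single {Q : FinQuiver V E} (hQ : Q.Loopless) (i : V) :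
    Q.quadForm (Pi.single i 1) = 1 := by
  have hprod : ∀ e, (Pi.single i 1 : V → ℤ) (Q.src e) * (Pi.single i 1 : V → ℤ) (Q.tgt e) = 0 := by
    intro e
    rcases eq_or_ne (Q.src e) i with rfl | hs
    · rw [Pi.single_eq_of_ne (hQ e).symm, mul_zero]
    · rw [Pi.single_eq_of_ne hs, zero_mul]
  simp only [quadForm, eulerForm, hprod, Finset.sum_const_zero, sub_zero]
  simp [Pi.single_apply]

end Forms

section Reflection

variable [Fintype V] [Fintype E] [DecidableEq V]

/-- The simple reflection `x ↦ x - (e_i, x) e_i` at the vertex `i`. It is an involution if there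
are no loops at `i`. -/
def reflection (Q : FinQuiver V E) (i : V) : Module.End ℤ (V → ℤ) :=
  Module.preReflection (Pi.single i 1) (Q.symmForm (Pi.single i 1))

theorem reflection_apply (Q : FinQuiver V E) (i : V) (x : V → ℤ) :
    Q.reflection i x = x - Q.symmForm (Pi.single i 1) x • Pi.single i 1 := rfl

theorem reflection_apply_self (Q : FinQuiver V E) (i : V) (x : V → ℤ) :
    Q.reflection i x i = x i - Q.symmForm (Pi.single i 1) x := by
  simp [reflection_apply]

theorem reflection_apply_of_ne (Q : FinQuiver V E) {i j : V} (hj : j ≠ i) (x : V → ℤ) :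
    Q.reflection i x j = x j := by
  simp [reflection_apply, hj]

theorem reflection_op (Q : FinQuiver V E) : Q.op.reflection = Q.reflection := by
  funext i
  rw [reflection, reflection, symmForm_op]

theorem reflection_reflect (Q : FinQuiver V E) (j : V) :
    (Q.reflect j).reflection = Q.reflection := by
  funext i
  rw [reflection, reflection, symmForm_reflect]

theorem IsSink.reflection_apply_sink {Q : FinQuiver V E} {i : V} (hi : Q.IsSink i) (x : V → ℤ) :
    Q.reflection i x i = ∑ e : {e : E // Q.tgt e = i}, x (Q.src e) - x i := by
  have hsum : ∑ e : {e : E // Q.tgt e = i}, x (Q.src e) =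
      ∑ e, if Q.tgt e = i then x (Q.src e) else 0 := by
    rw [← Finset.sum_filter]
    exact (Finset.sum_subtype _ (by simp) fun e => x (Q.src e)).symm
  simp only [Q.reflection_apply_self, symmForm_single, hi _, if_false, zero_add, hsum]
  ring

theorem IsSource.reflection_apply_source {Q : FinQuiver V E} {i : V} (hi : Q.IsSource i)
    (x : V → ℤ) :
    Q.reflection i x i = ∑ e : {e : E // Q.src e = i}, x (Q.tgt e) - x i := by
  rw [← reflection_op]
  exact IsSink.reflection_apply_sink (Q := Q.op) hi x

theorem Loopless.symmForm_single_self {Q : FinQuiver V E} (hQ : Q.Loopless) (i : V) :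
    Q.symmForm (Pi.single i 1) (Pi.single i 1) = 2 := by
  rw [symmForm_self, hQ.quadForm_single, mul_one]

theorem Loopless.reflection_single {Q : FinQuiver V E} (hQ : Q.Loopless) (i : V) :
    Q.reflection i (Pi.single i 1) = -Pi.single i 1 :=
  Module.preReflection_apply_self (hQ.symmForm_single_self i)

theorem Loopless.reflection_mul_self {Q : FinQuiver V E} (hQ : Q.Loopless) (i : V) :
    Q.reflection i * Q.reflection i = 1 :=
  LinearMap.ext <| Module.involutive_preReflection (hQ.symmForm_single_self i)

theorem Loopless.quadForm_reflection {Q : FinQuiver V E} (hQ : Q.Loopless) (i : V)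
    (x : V → ℤ) : Q.quadForm (Q.reflection i x) = Q.quadForm x := by
  have h := hQ.quadForm_single i
  simp only [quadForm, reflection_apply, symmForm_eq_add, ← eulerBilin_apply, map_sub, map_smul,
    LinearMap.sub_apply, LinearMap.smul_apply, smul_eq_mul] at h ⊢
  rw [h]
  ring

theorem IsSink.eulerForm_single {Q : FinQuiver V E} {i : V} (hi : Q.IsSink i) (y : V → ℤ) :
    Q.eulerForm (Pi.single i 1) y = y i := by
  simp [eulerForm, Pi.single_apply, hi _]

theorem IsSink.eulerForm_reflect {Q : FinQuiver V E} {i : V} (hi : Q.IsSink i) (x y : V → ℤ) :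
    (Q.reflect i).eulerForm x y = Q.eulerForm x y -
      Q.eulerForm x (Pi.single i 1) * y i + x i * Q.eulerForm y (Pi.single i 1) := by
  have h (z : V → ℤ) : Q.eulerForm z (Pi.single i 1) =
      z i - ∑ e, if Q.tgt e = i then z (Q.src e) else 0 := by
    simp [eulerForm, Pi.single_apply]
  have hE : ∑ e, x ((Q.reflect i).src e) * y ((Q.reflect i).tgt e) =
      ∑ e, (x (Q.src e) * y (Q.tgt e) - (if Q.tgt e = i then x (Q.src e) else 0) * y i +
        x i * if Q.tgt e = i then y (Q.src e) else 0) := by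
    refine Finset.sum_congr rfl fun e _ => ?_
    rcases eq_or_ne (Q.tgt e) i with ht | ht <;> simp [reflect, hi e, ht]
  rw [h, h, eulerForm, hE, Finset.sum_add_distrib, Finset.sum_sub_distrib, ← Finset.sum_mul,
    ← Finset.mul_sum, eulerForm]
  ring

theorem IsSink.eulerForm_reflection {Q : FinQuiver V E} {i : V} (hi : Q.IsSink i)
    (x y : V → ℤ) :
    (Q.reflect i).eulerForm (Q.reflection i x) (Q.reflection i y) = Q.eulerForm x y := by
  rw [hi.eulerForm_reflect, reflection_apply_self, reflection_apply_self]
  simp only [reflection_apply, symmForm_eq_add, ← eulerBilin_apply, map_sub, map_smul,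
    LinearMap.sub_apply, LinearMap.smul_apply, smul_eq_mul]
  simp only [eulerBilin_apply, hi.eulerForm_single, Pi.single_eq_same]
  ring

/-- The composite of the simple reflections at the vertices of a list, the first one being
applied first. -/
def reflectionList (Q : FinQuiver V E) (l : List V) : Module.End ℤ (V → ℤ) :=
  (l.map Q.reflection).reverse.prod

@[simp]
theorem reflectionList_nil (Q : FinQuiver V E) : Q.reflectionList [] = 1 := rfl

@[simp]
theorem reflectionList_cons (Q : FinQuiver V E) (i : V) (l : List V) :
    Q.reflectionList (i :: l) = Q.reflectionList l * Q.reflection i := by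
  simp [reflectionList]

theorem reflectionList_append (Q : FinQuiver V E) (l₁ l₂ : List V) :
    Q.reflectionList (l₁ ++ l₂) = Q.reflectionList l₂ * Q.reflectionList l₁ := by
  simp [reflectionList]

theorem reflectionList_op (Q : FinQuiver V E) : Q.op.reflectionList = Q.reflectionList := by
  funext l
  rw [reflectionList, reflectionList, reflection_op]

theorem reflectionList_reflect (Q : FinQuiver V E) (i : V) :
    (Q.reflect i).reflectionList = Q.reflectionList := by
  funext l
  rw [reflectionList, reflectionList, reflection_reflect]

theorem reflectionList_apply_of_notMem (Q : FinQuiver V E) {l : List V} {i : V} (hi : i ∉ l)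
    (x : V → ℤ) : Q.reflectionList l x i = x i := by
  induction l generalizing x with
  | nil => rfl
  | cons j l ih =>
    rw [List.mem_cons, not_or] at hi
    rw [reflectionList_cons, Module.End.mul_apply, ih hi.2, reflection_apply_of_ne Q hi.1]

theorem Loopless.reflectionList_reverse_mul {Q : FinQuiver V E} (hQ : Q.Loopless)
    (l : List V) : Q.reflectionList l.reverse * Q.reflectionList l = 1 := by
  induction l with
  | nil => rfl
  | cons i l ih =>
    rw [List.reverse_cons, reflectionList_append, reflectionList_cons Q i l, mul_assoc,
      ← mul_assoc (Q.reflectionList l.reverse), ih, one_mul, reflectionList_cons,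
      reflectionList_nil, one_mul, hQ.reflection_mul_self]

theorem Loopless.reflectionList_mul_reverse {Q : FinQuiver V E} (hQ : Q.Loopless)
    (l : List V) : Q.reflectionList l * Q.reflectionList l.reverse = 1 := by
  simpa only [List.reverse_reverse] using hQ.reflectionList_reverse_mul l.reverse

theorem SinkSequence.eulerForm_reflectionList {Q : FinQuiver V E} {l : List V}
    (hl : Q.SinkSequence l) (x y : V → ℤ) :
    (Q.reflectList l).eulerForm (Q.reflectionList l x) (Q.reflectionList l y) =
      Q.eulerForm x y := by
  induction l generalizing Q x y with
  | nil => rfl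
  | cons i l ih =>
    have h := ih hl.2 (Q.reflection i x) (Q.reflection i y)
    rw [reflectionList_reflect, hl.1.eulerForm_reflection] at h
    rw [reflectionList_cons]
    exact h

-- The reflections at `l₁` carry `⟨x, y⟩` to the value of the Euler form at the simple root `e_i`
-- of a sink `i` and a vector whose coordinate at `i` is still `y i`.
theorem SinkSequence.eulerForm_eq_apply {Q : FinQuiver V E} {l₁ l₂ : List V} {i : V}
    (hl : Q.SinkSequence (l₁ ++ i :: l₂)) (hi : i ∉ l₁) {x : V → ℤ}
    (hx : Q.reflectionList l₁ x = Pi.single i 1) (y : V → ℤ) : Q.eulerForm x y = y i := by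
  obtain ⟨hl₁, hl₂⟩ := (sinkSequence_append Q l₁ _).1 hl
  rw [← hl₁.eulerForm_reflectionList, hx, hl₂.1.eulerForm_single,
    reflectionList_apply_of_notMem Q hi]

/-- When the simple reflections at the vertices of a list are applied successively to `x`, one
never has to reflect a simple root at its own vertex. This is the condition under which the
reflection functors preserve indecomposability. -/
def AvoidsSimple (Q : FinQuiver V E) : List V → (V → ℤ) → Prop
  | [], _ => True
  | i :: l, x => x ≠ Pi.single i 1 ∧ Q.AvoidsSimple l (Q.reflection i x)

theorem avoidsSimple_congr {Q Q' : FinQuiver V E} (h : Q.reflection = Q'.reflection)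
    (l : List V) (x : V → ℤ) : Q.AvoidsSimple l x ↔ Q'.AvoidsSimple l x := by
  induction l generalizing x with
  | nil => rfl
  | cons i l ih => simp only [AvoidsSimple, h, ih]

theorem exists_reflectionList_eq_single_of_not_avoidsSimple {Q : FinQuiver V E} {l : List V}
    {x : V → ℤ} (h : ¬ Q.AvoidsSimple l x) :
    ∃ l₁ i l₂, l = l₁ ++ i :: l₂ ∧ Q.reflectionList l₁ x = Pi.single i 1 := by
  induction l generalizing x with
  | nil => exact absurd trivial h
  | cons i l ih =>
    by_cases hx : x = Pi.single i 1
    · exact ⟨[], i, l, rfl, hx⟩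
    · obtain ⟨l₁, j, l₂, rfl, hj⟩ := ih fun h' => h ⟨hx, h'⟩
      exact ⟨i :: l₁, j, l₂, rfl, by rwa [reflectionList_cons]⟩

namespace AdmissibleOrdering

variable {Q : FinQuiver V E} (o : Q.AdmissibleOrdering)

/-- The Coxeter transformation, the product of the simple reflections in the given ordering. -/
def coxeter : Module.End ℤ (V → ℤ) := Q.reflectionList o.list

theorem op_coxeter_mul_coxeter : o.op.coxeter * o.coxeter = 1 := by
  rw [coxeter, reflectionList_op]
  exact o.loopless.reflectionList_reverse_mul o.list

theorem coxeter_mul_op_coxeter : o.coxeter * o.op.coxeter = 1 := by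
  rw [coxeter, coxeter, reflectionList_op]
  exact o.loopless.reflectionList_mul_reverse o.list

theorem eulerForm_coxeter (x y : V → ℤ) :
    Q.eulerForm (o.coxeter x) (o.coxeter y) = Q.eulerForm x y := by
  have h := o.sinks.eulerForm_reflectionList x y
  rwa [Q.reflectList_eq_self o.list o.nodup o.mem] at h

theorem eulerForm_coxeter_pow (r : ℕ) (x y : V → ℤ) :
    Q.eulerForm ((o.coxeter ^ r) x) ((o.coxeter ^ r) y) = Q.eulerForm x y := by
  induction r with
  | zero => rfl
  | succ r ih =>
    simp only [pow_succ', Module.End.mul_apply]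
    rw [o.eulerForm_coxeter, ih]

theorem op_coxeter_pow_mul_coxeter_pow (r : ℕ) : o.op.coxeter ^ r * o.coxeter ^ r = 1 := by
  have hcomm : Commute o.op.coxeter o.coxeter :=
    o.op_coxeter_mul_coxeter.trans o.coxeter_mul_op_coxeter.symm
  rw [← hcomm.mul_pow, o.op_coxeter_mul_coxeter, one_pow]

theorem coxeter_pow_injective (r : ℕ) : Function.Injective (o.coxeter ^ r) :=
  Function.LeftInverse.injective (LinearMap.congr_fun (o.op_coxeter_pow_mul_coxeter_pow r))

end AdmissibleOrdering

end Reflection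

end FinQuiver

/-! ### Euclidean quivers -/

namespace FinQuiver

variable {V E : Type} [Fintype V] [Fintype E]

/-- The positive roots of `Q`. -/
def IsPosRoot (Q : FinQuiver V E) (x : V → ℤ) : Prop := Q.IsRoot x ∧ 0 < x

theorem isPosRoot_op (Q : FinQuiver V E) : Q.op.IsPosRoot = Q.IsPosRoot := by
  ext x
  rw [IsPosRoot, IsPosRoot, IsRoot, IsRoot, quadForm_op]

theorem symmForm_nonpos_of_disjoint (Q : FinQuiver V E) {x y : V → ℤ} (hx : 0 ≤ x) (hy : 0 ≤ y)
    (hxy : ∀ i, x i * y i = 0) : Q.symmForm x y ≤ 0 := by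
  rw [symmForm_eq_sub, Finset.sum_eq_zero fun i _ => hxy i, mul_zero, zero_sub, neg_nonpos]
  exact Finset.sum_nonneg fun e _ =>
    add_nonneg (mul_nonneg (hx _) (hy _)) (mul_nonneg (hx _) (hy _))

/-- The quiver `Q` is connected and `δ` is a positive vector in the radical of its quadratic
form. By the classification of these quivers, they are those whose underlying graph is a Euclidean
diagram, and `δ` is a multiple of the vector of marks. -/
structure IsEuclidean (Q : FinQuiver V E) (δ : V → ℤ) : Prop where
  pos : ∀ i, 0 < δ i
  radical : Q.symmForm δ = 0
  connected : ∀ P : V → Prop, (∀ e, P (Q.src e) ↔ P (Q.tgt e)) → ∀ i j, P i → P j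

namespace IsEuclidean

variable {Q : FinQuiver V E} {δ : V → ℤ}

theorem op (h : Q.IsEuclidean δ) : Q.op.IsEuclidean δ where
  pos := h.pos
  radical := by rw [symmForm_op, h.radical]
  connected P hP := h.connected P fun e => (hP e).symm

theorem symmForm_right (h : Q.IsEuclidean δ) (x : V → ℤ) : Q.symmForm x δ = 0 := by
  rw [symmForm_comm, h.radical, LinearMap.zero_apply]

theorem eulerForm_swap (h : Q.IsEuclidean δ) (x : V → ℤ) :
    Q.eulerForm x δ = -Q.eulerForm δ x :=
  eq_neg_of_add_eq_zero_left (h.symmForm_right x)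

theorem eulerForm_self (h : Q.IsEuclidean δ) : Q.eulerForm δ δ = 0 := by
  linarith [h.eulerForm_swap δ]

theorem quadForm_add_smul (h : Q.IsEuclidean δ) (x : V → ℤ) (a : ℤ) :
    Q.quadForm (x + a • δ) = Q.quadForm x := by
  have hδ : Q.quadForm (a • δ) = 0 := by
    rw [quadForm, ← eulerBilin_apply, map_smul, map_smul, LinearMap.smul_apply, eulerBilin_apply,
      h.eulerForm_self, smul_zero, smul_zero]
  rw [quadForm_add, hδ, map_smul, h.symmForm_right, smul_zero, add_zero, add_zero]

theorem sum_mul_radical (h : Q.IsEuclidean δ) (w : V → ℚ) :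
    ∑ e, (w (Q.src e) * δ (Q.tgt e) + w (Q.tgt e) * δ (Q.src e)) = 2 * ∑ i, w i * δ i := by
  classical
  have hδ (i : V) : (2 * δ i : ℚ) = ∑ e, ((if Q.src e = i then (δ (Q.tgt e) : ℚ) else 0) +
      if Q.tgt e = i then (δ (Q.src e) : ℚ) else 0) := by
    have hi := h.symmForm_right (Pi.single i 1)
    rw [symmForm_single, sub_eq_zero] at hi
    exact_mod_cast hi
  simp only [Finset.mul_sum, mul_left_comm 2 (w _), hδ]
  rw [Finset.sum_comm]
  simp [mul_add, Finset.sum_add_distrib]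

theorem two_mul_quadForm (h : Q.IsEuclidean δ) (z : V → ℤ) :
    (2 * Q.quadForm z : ℚ) = ∑ e, (δ (Q.src e) * δ (Q.tgt e) : ℚ) *
      (z (Q.src e) / δ (Q.src e) - z (Q.tgt e) / δ (Q.tgt e)) ^ 2 := by
  have hδ (i : V) : (δ i : ℚ) ≠ 0 := by exact_mod_cast (h.pos i).ne'
  have hsquare (e : E) : (δ (Q.src e) * δ (Q.tgt e) : ℚ) *
      (z (Q.src e) / δ (Q.src e) - z (Q.tgt e) / δ (Q.tgt e)) ^ 2 =
      ((z (Q.src e) ^ 2 / δ (Q.src e) : ℚ) * δ (Q.tgt e) +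
        (z (Q.tgt e) ^ 2 / δ (Q.tgt e) : ℚ) * δ (Q.src e)) -
      2 * (z (Q.src e) * z (Q.tgt e)) := by
    have := hδ (Q.src e)
    have := hδ (Q.tgt e)
    field_simp
    ring
  have hdiag (i : V) : (z i ^ 2 / δ i : ℚ) * δ i = z i * z i := by
    rw [div_mul_cancel₀ _ (hδ i), sq]
  rw [Finset.sum_congr rfl fun e _ => hsquare e, Finset.sum_sub_distrib,
    h.sum_mul_radical fun i => (z i ^ 2 / δ i : ℚ), Finset.sum_congr rfl fun i _ => hdiag i,
    ← Finset.mul_sum, quadForm, eulerForm]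
  push_cast
  ring

theorem sq_sub_le (h : Q.IsEuclidean δ) (z : V → ℤ) (e : E) :
    (z (Q.src e) * δ (Q.tgt e) - z (Q.tgt e) * δ (Q.src e)) ^ 2 ≤
      2 * Q.quadForm z * (δ (Q.src e) * δ (Q.tgt e)) := by
  have hδ (i : V) : (0 : ℚ) < δ i := by exact_mod_cast h.pos i
  have hle : (δ (Q.src e) * δ (Q.tgt e) : ℚ) *
      (z (Q.src e) / δ (Q.src e) - z (Q.tgt e) / δ (Q.tgt e)) ^ 2 ≤ 2 * Q.quadForm z := by
    rw [h.two_mul_quadForm]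
    exact Finset.single_le_sum (f := fun e => (δ (Q.src e) * δ (Q.tgt e) : ℚ) *
      (z (Q.src e) / δ (Q.src e) - z (Q.tgt e) / δ (Q.tgt e)) ^ 2)
      (fun e _ => mul_nonneg (mul_pos (hδ _) (hδ _)).le (sq_nonneg _)) (Finset.mem_univ e)
  have hclear : (δ (Q.src e) * δ (Q.tgt e) : ℚ) *
      (z (Q.src e) / δ (Q.src e) - z (Q.tgt e) / δ (Q.tgt e)) ^ 2 *
      (δ (Q.src e) * δ (Q.tgt e)) =
      (z (Q.src e) * δ (Q.tgt e) - z (Q.tgt e) * δ (Q.src e)) ^ 2 := by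
    have := (hδ (Q.src e)).ne'
    have := (hδ (Q.tgt e)).ne'
    field_simp
  have hmul := mul_le_mul_of_nonneg_right hle (mul_pos (hδ (Q.src e)) (hδ (Q.tgt e))).le
  rw [hclear] at hmul
  exact_mod_cast hmul

theorem quadForm_nonneg (h : Q.IsEuclidean δ) (z : V → ℤ) : 0 ≤ Q.quadForm z := by
  have hδ (i : V) : (0 : ℚ) < δ i := by exact_mod_cast h.pos i
  have h2 : (0 : ℚ) ≤ 2 * Q.quadForm z := by
    rw [h.two_mul_quadForm]
    exact Finset.sum_nonneg fun e _ => mul_nonneg (mul_pos (hδ _) (hδ _)).le (sq_nonneg _)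
  exact_mod_cast nonneg_of_mul_nonneg_right h2 two_pos

theorem mul_eq_mul_of_quadForm_eq_zero (h : Q.IsEuclidean δ) {z : V → ℤ}
    (hz : Q.quadForm z = 0) (i j : V) : z i * δ j = z j * δ i := by
  refine h.connected (fun i => z i * δ j = z j * δ i) (fun e => ?_) j i rfl
  have he : z (Q.src e) * δ (Q.tgt e) = z (Q.tgt e) * δ (Q.src e) := by
    have hsq := h.sq_sub_le z e
    rw [hz, mul_zero, zero_mul] at hsq
    exact sub_eq_zero.1 (pow_eq_zero_iff two_ne_zero |>.1 (le_antisymm hsq (sq_nonneg _)))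
  constructor <;> intro h'
  · refine mul_left_cancel₀ (h.pos (Q.src e)).ne' ?_
    linear_combination δ (Q.tgt e) * h' - δ j * he
  · refine mul_left_cancel₀ (h.pos (Q.tgt e)).ne' ?_
    linear_combination δ (Q.src e) * h' + δ j * he

theorem eq_zero_or_pos_of_quadForm_eq_zero (h : Q.IsEuclidean δ) {z : V → ℤ}
    (hz : Q.quadForm z = 0) (hz0 : 0 ≤ z) : z = 0 ∨ ∀ i, 0 < z i := by
  refine or_iff_not_imp_left.2 fun hne i => ?_
  obtain ⟨j, hj⟩ := Function.ne_iff.1 hne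
  have hj : 0 < z j := lt_of_le_of_ne (hz0 j) (Ne.symm hj)
  have hij := h.mul_eq_mul_of_quadForm_eq_zero hz i j
  exact pos_of_mul_pos_left (hij ▸ mul_pos hj (h.pos i)) (h.pos j).le

theorem quadForm_pos_of_defect_ne_zero (h : Q.IsEuclidean δ) {z : V → ℤ}
    (hz : Q.eulerForm δ z ≠ 0) : 0 < Q.quadForm z := by
  refine lt_of_le_of_ne (h.quadForm_nonneg z) fun hq => hz ?_
  cases isEmpty_or_nonempty V with
  | inl _ => rw [Subsingleton.elim z δ, h.eulerForm_self]
  | inr hV =>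
    obtain ⟨j⟩ := hV
    have hprop : δ j • z = z j • δ := funext fun i => by
      simpa only [Pi.smul_apply, smul_eq_mul, mul_comm (δ j)] using
        h.mul_eq_mul_of_quadForm_eq_zero hq.symm i j
    have hmul : δ j * Q.eulerForm δ z = 0 := by
      rw [← eulerBilin_apply, ← smul_eq_mul, ← map_smul, hprop, map_smul, eulerBilin_apply,
        h.eulerForm_self, smul_zero]
    exact (mul_eq_zero.1 hmul).resolve_left (h.pos j).ne'

-- `q(x) ≥ q(x⁺) + q(x⁻)`, so one of `x⁺` and `x⁻` is a multiple of `δ`; their supports being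
-- disjoint, the other one is zero or this one is.
theorem nonneg_or_nonpos (h : Q.IsEuclidean δ) {x : V → ℤ} (hx : Q.quadForm x ≤ 1) :
    0 ≤ x ∨ x ≤ 0 := by
  have hdisj (i : V) : x⁺ i * x⁻ i = 0 := by
    simp only [Pi.posPart_apply, Pi.negPart_apply]
    rcases le_total 0 (x i) with hi | hi
    · rw [negPart_eq_zero.2 hi, mul_zero]
    · rw [posPart_eq_zero.2 hi, zero_mul]
  have hcross := Q.symmForm_nonpos_of_disjoint (posPart_nonneg x) (negPart_nonneg x) hdisj
  have hq := Q.quadForm_add x⁺ (-x⁻)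
  rw [← sub_eq_add_neg, posPart_sub_negPart, quadForm_neg, map_neg] at hq
  have hqp := h.quadForm_nonneg x⁺
  have hqm := h.quadForm_nonneg x⁻
  rcases (show Q.quadForm x⁺ = 0 ∨ Q.quadForm x⁻ = 0 by lia) with h0 | h0
  · rcases h.eq_zero_or_pos_of_quadForm_eq_zero h0 (posPart_nonneg x) with hp | hp
    · exact Or.inr (posPart_eq_zero.1 hp)
    · exact Or.inl (negPart_eq_zero.1 (funext fun i =>
        (mul_eq_zero.1 (hdisj i)).resolve_left (hp i).ne'))
  · rcases h.eq_zero_or_pos_of_quadForm_eq_zero h0 (negPart_nonneg x) with hm | hm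
    · exact Or.inl (negPart_eq_zero.1 hm)
    · exact Or.inr (posPart_eq_zero.1 (funext fun i =>
        (mul_eq_zero.1 (hdisj i)).resolve_right (hm i).ne'))

end IsEuclidean

theorem abs_le_of_sq_sub_le {a b u v C : ℤ} (ha : 0 < a) (hb : 0 < b)
    (h : (u * b - v * a) ^ 2 ≤ C) : |v| ≤ |u| * b + C :=
  calc |v| ≤ |v| * a := le_mul_of_one_le_right (abs_nonneg v) ha
    _ = |u * b - (u * b - v * a)| := by rw [sub_sub_cancel, abs_mul, abs_of_pos ha]
    _ ≤ |u * b| + |u * b - v * a| := abs_sub _ _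
    _ ≤ |u| * b + C := by
      rw [abs_mul, abs_of_pos hb]
      gcongr
      exact (Int.le_self_sq _).trans ((sq_abs _).trans_le h)

namespace IsEuclidean

variable {Q : FinQuiver V E} {δ : V → ℤ}

theorem finite_setOf_abs_apply_le (h : Q.IsEuclidean δ) (j : V) (B K : ℤ) :
    {z : V → ℤ | |z j| ≤ B ∧ Q.quadForm z ≤ K}.Finite := by
  have hbounded (i : V) : ∃ C : ℤ, ∀ z : V → ℤ, |z j| ≤ B ∧ Q.quadForm z ≤ K → |z i| ≤ C := by
    refine h.connected (fun i => ∃ C : ℤ, ∀ z : V → ℤ, |z j| ≤ B ∧ Q.quadForm z ≤ K → |z i| ≤ C)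
      (fun e => ?_) j i ⟨B, fun z hz => hz.1⟩
    have hs := h.pos (Q.src e)
    have ht := h.pos (Q.tgt e)
    have hsq (z : V → ℤ) (hz : Q.quadForm z ≤ K) :
        (z (Q.src e) * δ (Q.tgt e) - z (Q.tgt e) * δ (Q.src e)) ^ 2 ≤
          2 * K * (δ (Q.src e) * δ (Q.tgt e)) :=
      (h.sq_sub_le z e).trans (by gcongr)
    constructor
    · rintro ⟨C, hC⟩
      exact ⟨C * δ (Q.tgt e) + 2 * K * (δ (Q.src e) * δ (Q.tgt e)), fun z hz =>
        (abs_le_of_sq_sub_le hs ht (hsq z hz.2)).trans (by gcongr; exact hC z hz)⟩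
    · rintro ⟨C, hC⟩
      exact ⟨C * δ (Q.src e) + 2 * K * (δ (Q.src e) * δ (Q.tgt e)), fun z hz =>
        (abs_le_of_sq_sub_le ht hs ((sub_sq_comm _ _).trans_le (hsq z hz.2))).trans
          (by gcongr; exact hC z hz)⟩
  choose C hC using hbounded
  classical
  exact (Set.finite_Icc (fun i => -C i) C).subset fun z hz =>
    ⟨fun i => (abs_le.1 (hC i z hz)).1, fun i => (abs_le.1 (hC i z hz)).2⟩

variable [DecidableEq V]

theorem isPosRoot_reflection (h : Q.IsEuclidean δ) (hQ : Q.Loopless) {x : V → ℤ}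
    (hx : Q.IsPosRoot x) {i : V} (hi : x ≠ Pi.single i 1) : Q.IsPosRoot (Q.reflection i x) := by
  have hq : Q.quadForm (Q.reflection i x) ≤ 1 := by
    rw [hQ.quadForm_reflection]
    exact hx.1.2
  -- A positive root supported at `i` alone is the simple root at `i`.
  obtain ⟨j, hji, hj⟩ : ∃ j, j ≠ i ∧ 0 < x j := by
    by_contra! hsupp
    have hxi : x = x i • Pi.single i 1 := by
      ext j
      rcases eq_or_ne j i with rfl | hj
      · simp
      · simpa [hj] using le_antisymm (hsupp j hj) (hx.2.le j)
    have h0 : 0 < x i := lt_of_le_of_ne (hx.2.le i) fun h0 => hx.1.1 (by rw [hxi, ← h0, zero_smul])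
    have h1 : x i ≠ 1 := fun h1 => hi (by rw [hxi, h1, one_smul])
    have hsq := hx.1.2
    rw [hxi, quadForm, ← eulerBilin_apply, map_smul, map_smul, LinearMap.smul_apply,
      eulerBilin_apply, ← quadForm, hQ.quadForm_single] at hsq
    simp only [smul_eq_mul] at hsq
    nlinarith [show 2 ≤ x i by lia]
  have hj' : 0 < Q.reflection i x j := by rwa [reflection_apply_of_ne Q hji]
  have hne : Q.reflection i x ≠ 0 := fun h0 => by simp [h0] at hj'
  refine ⟨⟨hne, hq⟩, lt_of_le_of_ne ?_ hne.symm⟩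
  exact (h.nonneg_or_nonpos hq).resolve_right fun hle => (hle j).not_gt hj'

theorem isPosRoot_reflectionList (h : Q.IsEuclidean δ) (hQ : Q.Loopless) {l : List V}
    {x : V → ℤ} (hx : Q.IsPosRoot x) (hl : Q.AvoidsSimple l x) :
    Q.IsPosRoot (Q.reflectionList l x) := by
  induction l generalizing x with
  | nil => exact hx
  | cons i l ih =>
    rw [reflectionList_cons]
    exact ih (h.isPosRoot_reflection hQ hx hl.1) hl.2

theorem reflectionList_self (h : Q.IsEuclidean δ) (l : List V) : Q.reflectionList l δ = δ := by
  induction l with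
  | nil => rfl
  | cons i l ih =>
    rw [reflectionList_cons, Module.End.mul_apply, reflection_apply, h.symmForm_right, zero_smul,
      sub_zero, ih]

variable (o : Q.AdmissibleOrdering)

theorem coxeter_pow_self (h : Q.IsEuclidean δ) (r : ℕ) : (o.coxeter ^ r) δ = δ := by
  rw [Module.End.pow_apply]
  exact Function.iterate_fixed (h.reflectionList_self o.list) r

theorem defect_coxeter_pow (h : Q.IsEuclidean δ) (r : ℕ) (x : V → ℤ) :
    Q.eulerForm δ ((o.coxeter ^ r) x) = Q.eulerForm δ x := by
  conv_lhs => rw [← h.coxeter_pow_self o r, o.eulerForm_coxeter_pow]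

-- Modulo `δ`, the orbit of `x` stays in a finite set.
theorem exists_coxeter_pow_eq_add_smul (h : Q.IsEuclidean δ) (x : V → ℤ) :
    ∃ (m : ℕ) (t : ℤ), (o.coxeter ^ (m + 1)) x = x + t • δ := by
  cases isEmpty_or_nonempty V with
  | inl _ => exact ⟨0, 0, Subsingleton.elim _ _⟩
  | inr hV =>
    obtain ⟨j⟩ := hV
    let y (r : ℕ) : V → ℤ := (o.coxeter ^ r) x
    let z (r : ℕ) : V → ℤ := y r + (-(y r j / δ j)) • δ
    have hz (r : ℕ) : z r ∈ {z : V → ℤ | |z j| ≤ δ j ∧ Q.quadForm z ≤ Q.quadForm x} := by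
      constructor
      · have hmod : z r j = y r j % δ j := by
          simp only [z, Pi.add_apply, Pi.smul_apply, smul_eq_mul, Int.emod_def]
          ring
        rw [hmod, abs_of_nonneg (Int.emod_nonneg _ (h.pos j).ne')]
        exact (Int.emod_lt_of_pos _ (h.pos j)).le
      · rw [h.quadForm_add_smul, quadForm, o.eulerForm_coxeter_pow, quadForm]
    obtain ⟨a, -, b, -, hab, hzab⟩ := Set.infinite_univ.exists_lt_map_eq_of_mapsTo
      (fun r _ => hz r) (h.finite_setOf_abs_apply_le j (δ j) (Q.quadForm x))
    obtain ⟨m, rfl⟩ := Nat.exists_eq_add_of_lt hab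
    refine ⟨m, y (a + m + 1) j / δ j - y a j / δ j, o.coxeter_pow_injective a ?_⟩
    have hy : y (a + m + 1) = y a + (y (a + m + 1) j / δ j - y a j / δ j) • δ := by
      linear_combination -hzab
    rw [map_add, map_smul, h.coxeter_pow_self, ← Module.End.mul_apply, ← pow_add, ← add_assoc]
    exact hy

theorem coxeter_pow_eq_add_smul (h : Q.IsEuclidean δ) {y : V → ℤ} {t : ℤ}
    (hy : o.coxeter y = y + t • δ) (s : ℕ) : (o.coxeter ^ s) y = y + (s * t) • δ := by
  induction s with
  | zero => simp
  | succ s ih =>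
    rw [pow_succ, Module.End.mul_apply, hy, map_add, map_smul, h.coxeter_pow_self, ih]
    push_cast
    module

end IsEuclidean

/-- For all `i`, the vectors `p i` and `h i` represent the `i`-th coordinate with respect to the
Euler form, from the left and from the right. These are the properties of the dimension vectors of
`P(i)` and `I(i)` from which the preprojective and preinjective roots are determined. -/
structure DualFamilies (Q : FinQuiver V E) (p h : V → V → ℤ) : Prop where
  eulerForm_p : ∀ i y, Q.eulerForm (p i) y = y i
  eulerForm_h : ∀ i y, Q.eulerForm y (h i) = y i
  p_nonneg : ∀ i, 0 ≤ p i
  h_nonneg : ∀ i, 0 ≤ h i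

end FinQuiver

/-! ### Preprojective and preinjective roots -/

namespace FinQuiver

theorem exists_not_nonneg_add_mul_smul {ι : Type*} [Nonempty ι] {δ : ι → ℤ} (y : ι → ℤ)
    (hδ : ∀ i, 0 < δ i) {t : ℤ} (ht : t < 0) : ∃ s : ℕ, ¬ 0 ≤ y + (s * t) • δ := by
  obtain ⟨i⟩ := ‹Nonempty ι›
  refine ⟨(y i).natAbs + 1, fun hs => ?_⟩
  have hi := hs i
  simp only [Pi.zero_apply, Pi.add_apply, Pi.smul_apply, smul_eq_mul, Nat.cast_add,
    Int.natCast_natAbs, Nat.cast_one] at hi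
  have htδ : t * δ i ≤ -1 := by nlinarith [hδ i]
  nlinarith [le_abs_self (y i), abs_nonneg (y i)]

namespace DualFamilies

variable {V E : Type} [Fintype V] [Fintype E] {Q : FinQuiver V E} {δ : V → ℤ}
  {p h : V → V → ℤ}

theorem op (D : Q.DualFamilies p h) : Q.op.DualFamilies h p where
  eulerForm_p i y := (eulerForm_op Q _ _).trans (D.eulerForm_h i y)
  eulerForm_h i y := (eulerForm_op Q _ _).trans (D.eulerForm_p i y)
  p_nonneg := D.h_nonneg
  h_nonneg := D.p_nonneg

theorem defect_p (D : Q.DualFamilies p h) (H : Q.IsEuclidean δ) (i : V) :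
    Q.eulerForm δ (p i) = -δ i := by
  rw [← D.eulerForm_p i δ, H.eulerForm_swap, neg_neg]

theorem eq_of_eulerForm_eq (D : Q.DualFamilies p h) {x x' : V → ℤ}
    (hx : ∀ y, Q.eulerForm x y = Q.eulerForm x' y) : x = x' := by
  ext i
  rw [← D.eulerForm_h i x, hx, D.eulerForm_h]

theorem h_injective (D : Q.DualFamilies p h) : Function.Injective h := fun i j hij => by
  classical
  have h1 : (Pi.single i 1 : V → ℤ) i = (Pi.single i 1 : V → ℤ) j := by
    rw [← D.eulerForm_h i (Pi.single i 1), hij, D.eulerForm_h]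
  by_contra hne
  simp [Ne.symm hne] at h1

variable [DecidableEq V]

theorem sum_eulerForm_single_smul (D : Q.DualFamilies p h) (x : V → ℤ) :
    ∑ i, Q.eulerForm x (Pi.single i 1) • p i = x :=
  D.eq_of_eulerForm_eq fun y => by
    rw [eulerForm_eq_sum Q x, ← eulerBilin_apply, map_sum, LinearMap.sum_apply]
    refine Finset.sum_congr rfl fun i _ => ?_
    rw [map_smul, LinearMap.smul_apply, eulerBilin_apply, D.eulerForm_p, smul_eq_mul]

variable (o : Q.AdmissibleOrdering)

theorem eq_p_of_reflectionList_eq_single (D : Q.DualFamilies p h) {l₁ l₂ : List V} {i : V}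
    (hl : o.list = l₁ ++ i :: l₂) {x : V → ℤ} (hx : Q.reflectionList l₁ x = Pi.single i 1) :
    x = p i := by
  have hsinks := hl ▸ o.sinks
  refine D.eq_of_eulerForm_eq fun y => ?_
  rw [D.eulerForm_p, hsinks.eulerForm_eq_apply (o.notMem_of_list_eq hl) hx]

theorem exists_eq_p_of_not_avoidsSimple (D : Q.DualFamilies p h) {x : V → ℤ}
    (hx : ¬ Q.AvoidsSimple o.list x) : ∃ i, x = p i := by
  obtain ⟨l₁, i, l₂, hl, hi⟩ := exists_reflectionList_eq_single_of_not_avoidsSimple hx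
  exact ⟨i, D.eq_p_of_reflectionList_eq_single o hl hi⟩

theorem reflectionList_reverse_single (D : Q.DualFamilies p h) {l₁ l₂ : List V} {i : V}
    (hl : o.list = l₁ ++ i :: l₂) : Q.reflectionList l₁.reverse (Pi.single i 1) = p i := by
  refine D.eq_p_of_reflectionList_eq_single o hl ?_
  exact LinearMap.congr_fun (o.loopless.reflectionList_mul_reverse l₁) _

theorem reflectionList_p (D : Q.DualFamilies p h) {l₁ l₂ : List V} {i : V}
    (hl : o.list = l₁ ++ i :: l₂) : Q.reflectionList l₁ (p i) = Pi.single i 1 := by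
  rw [← D.reflectionList_reverse_single o hl]
  exact LinearMap.congr_fun (o.loopless.reflectionList_mul_reverse l₁) _

-- The reflections before `i` carry `p i` to `e_i`, the one at `i` changes the sign, and the
-- remaining ones carry `e_i` to `h i` by the dual of the first step.
theorem coxeter_p (D : Q.DualFamilies p h) (i : V) : o.coxeter (p i) = -h i := by
  obtain ⟨l₁, l₂, hl⟩ := List.append_of_mem (o.mem i)
  have hl' : o.op.list = l₂.reverse ++ i :: l₁.reverse := by
    simp [AdmissibleOrdering.op, hl]
  have hh : Q.reflectionList l₂ (Pi.single i 1) = h i := by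
    rw [← D.op.reflectionList_reverse_single o.op hl', reflectionList_op, List.reverse_reverse]
  rw [AdmissibleOrdering.coxeter, hl, reflectionList_append, Module.End.mul_apply,
    D.reflectionList_p o hl, reflectionList_cons, Module.End.mul_apply,
    o.loopless.reflection_single, map_neg, hh]

theorem isPosRoot_p (D : Q.DualFamilies p h) (o : Q.AdmissibleOrdering) (i : V) :
    Q.IsPosRoot (p i) := by
  have hne : p i ≠ 0 := fun h0 => by
    have h1 := D.eulerForm_p i 1
    rw [h0, ← eulerBilin_apply, map_zero] at h1
    exact zero_ne_one h1
  have hq : Q.quadForm (p i) = 1 := by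
    obtain ⟨l₁, l₂, hl⟩ := List.append_of_mem (o.mem i)
    rw [quadForm, D.eulerForm_p, ← reflectionList_apply_of_notMem Q (o.notMem_of_list_eq hl) (p i),
      D.reflectionList_p o hl, Pi.single_eq_same]
  exact ⟨⟨hne, hq.le⟩, lt_of_le_of_ne (D.p_nonneg i) hne.symm⟩

theorem eulerForm_coxeter_right (D : Q.DualFamilies p h) (x y : V → ℤ) :
    Q.eulerForm y (o.coxeter x) = -Q.eulerForm x y := by
  conv_lhs => rw [← D.sum_eulerForm_single_smul x]
  rw [eulerForm_eq_sum Q x, ← Finset.sum_neg_distrib, ← eulerBilin_apply, map_sum, map_sum]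
  refine Finset.sum_congr rfl fun i _ => ?_
  rw [map_smul, D.coxeter_p o, map_smul, map_neg, eulerBilin_apply, D.eulerForm_h, smul_eq_mul,
    mul_neg]

theorem avoidsSimple_of_defect_pos (D : Q.DualFamilies p h) (H : Q.IsEuclidean δ) {x : V → ℤ}
    (hx : 0 < Q.eulerForm δ x) : Q.AvoidsSimple o.list x := by
  by_contra hcon
  obtain ⟨i, rfl⟩ := D.exists_eq_p_of_not_avoidsSimple o hcon
  rw [D.defect_p H] at hx
  linarith [H.pos i]

theorem defect_coxeter_pow_h (D : Q.DualFamilies p h) (H : Q.IsEuclidean δ) (r : ℕ) (i : V) :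
    Q.eulerForm δ ((o.coxeter ^ r) (h i)) = δ i := by
  rw [H.defect_coxeter_pow, D.eulerForm_h]

theorem avoidsSimple_coxeter_pow_h (D : Q.DualFamilies p h) (H : Q.IsEuclidean δ) (r : ℕ)
    (i : V) : Q.AvoidsSimple o.list ((o.coxeter ^ r) (h i)) :=
  D.avoidsSimple_of_defect_pos o H ((H.pos i).trans_eq (D.defect_coxeter_pow_h o H r i).symm)

theorem isPosRoot_coxeter_pow_h (D : Q.DualFamilies p h) (H : Q.IsEuclidean δ) (r : ℕ)
    (i : V) : Q.IsPosRoot ((o.coxeter ^ r) (h i)) := by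
  induction r with
  | zero => exact Q.isPosRoot_op ▸ D.op.isPosRoot_p o.op i
  | succ r ih =>
    rw [pow_succ', Module.End.mul_apply]
    exact H.isPosRoot_reflectionList o.loopless ih (D.avoidsSimple_coxeter_pow_h o H r i)

-- Otherwise `c⁻¹ (h i) = - p i` would be positive.
theorem coxeter_pow_succ_h_ne (D : Q.DualFamilies p h) (H : Q.IsEuclidean δ) (i j : V) (r : ℕ) :
    (o.coxeter ^ (r + 1)) (h j) ≠ h i := fun hr => by
  have hinv : (o.coxeter ^ r) (h j) = -p i := by
    rw [← D.op.coxeter_p o.op, ← hr, pow_succ', ← Module.End.mul_apply, ← mul_assoc,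
      o.op_coxeter_mul_coxeter, one_mul]
  have hpos := (D.isPosRoot_coxeter_pow_h o H r j).2
  rw [hinv, neg_pos] at hpos
  exact hpos.not_ge (D.p_nonneg i)

theorem coxeter_pow_h_injective (D : Q.DualFamilies p h) (H : Q.IsEuclidean δ) :
    Function.Injective fun a : V × ℕ => (o.coxeter ^ a.2) (h a.1) := by
  rintro ⟨i, r⟩ ⟨j, s⟩ hrs
  dsimp only at hrs
  induction r generalizing s with
  | zero =>
    cases s with
    | zero => rw [D.h_injective hrs]
    | succ s => exact absurd hrs.symm (D.coxeter_pow_succ_h_ne o H i j s)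
  | succ r ih =>
    cases s with
    | zero => exact absurd hrs (D.coxeter_pow_succ_h_ne o H j i r)
    | succ s =>
      rw [pow_succ', pow_succ', Module.End.mul_apply, Module.End.mul_apply] at hrs
      have hinj : Function.Injective o.coxeter := by simpa using o.coxeter_pow_injective 1
      obtain ⟨rfl, rfl⟩ := Prod.ext_iff.1 (ih s (hinj hrs))
      rfl

-- `⟨y, y⟩ = -⟨y, c y⟩ = -⟨y, y⟩ - t ⟨y, δ⟩`.
theorem two_mul_quadForm_of_coxeter_eq (D : Q.DualFamilies p h) (H : Q.IsEuclidean δ)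
    {y : V → ℤ} {t : ℤ} (hy : o.coxeter y = y + t • δ) :
    2 * Q.quadForm y = t * Q.eulerForm δ y := by
  have h1 := D.eulerForm_coxeter_right o y y
  rw [hy, ← eulerBilin_apply, map_add, map_smul, eulerBilin_apply, eulerBilin_apply,
    H.eulerForm_swap, smul_eq_mul] at h1
  rw [quadForm]
  linarith

-- If `c ^ (m + 1)` translates `x` by `t δ`, then `c` translates `x + c x + ⋯ + c ^ m x` by `t δ`.
theorem exists_coxeter_pow_not_nonneg (D : Q.DualFamilies p h) (H : Q.IsEuclidean δ)
    {x : V → ℤ} (hx : Q.eulerForm δ x < 0) : ∃ r, ¬ 0 ≤ (o.coxeter ^ r) x := by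
  by_contra! hnonneg
  obtain ⟨m, t, hm⟩ := H.exists_coxeter_pow_eq_add_smul o x
  set y := ∑ r ∈ Finset.range (m + 1), (o.coxeter ^ r) x with hy
  have hcy : o.coxeter y = y + t • δ := by
    have hgeom := LinearMap.congr_fun (mul_geom_sum o.coxeter (m + 1)) x
    simp only [sub_mul, one_mul, LinearMap.sub_apply, Module.End.mul_apply, LinearMap.sum_apply,
      Module.End.one_apply, hm, ← hy, add_sub_cancel_left] at hgeom
    rw [← hgeom, add_sub_cancel]
  have hdefect : Q.eulerForm δ y < 0 := by
    rw [hy, ← eulerBilin_apply, map_sum]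
    refine Finset.sum_neg (fun r _ => ?_) ⟨0, by simp⟩
    rwa [eulerBilin_apply, H.defect_coxeter_pow]
  have ht : t < 0 := by
    have hq := H.quadForm_pos_of_defect_ne_zero hdefect.ne
    have h2q := D.two_mul_quadForm_of_coxeter_eq o H hcy
    exact neg_of_mul_pos_left (by linarith) hdefect.le
  have hpos (s : ℕ) : 0 ≤ y + (s * t) • δ := by
    rw [← H.coxeter_pow_eq_add_smul o hcy, hy, map_sum]
    refine Finset.sum_nonneg fun r _ => ?_
    rw [← Module.End.mul_apply, ← pow_add]
    exact hnonneg _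
  have : Nonempty V := by
    by_contra hV
    rw [not_nonempty_iff] at hV
    rw [Subsingleton.elim y δ, H.eulerForm_self] at hdefect
    exact lt_irrefl _ hdefect
  obtain ⟨s, hs⟩ := exists_not_nonneg_add_mul_smul y H.pos ht
  exact hs (hpos s)

theorem exists_eq_coxeter_pow_p (D : Q.DualFamilies p h) (H : Q.IsEuclidean δ) {x : V → ℤ}
    (hx : Q.IsPosRoot x) (hd : Q.eulerForm δ x < 0) :
    ∃ i r, (o.op.coxeter ^ r) (p i) = x := by
  by_contra! hcon
  have havoid (r : ℕ) : Q.AvoidsSimple o.list ((o.coxeter ^ r) x) := by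
    by_contra ha
    obtain ⟨i, hi⟩ := D.exists_eq_p_of_not_avoidsSimple o ha
    exact hcon i r (hi ▸ LinearMap.congr_fun (o.op_coxeter_pow_mul_coxeter_pow r) x)
  have hpos (r : ℕ) : Q.IsPosRoot ((o.coxeter ^ r) x) := by
    induction r with
    | zero => exact hx
    | succ r ih =>
      rw [pow_succ', Module.End.mul_apply]
      exact H.isPosRoot_reflectionList o.loopless ih (havoid r)
  obtain ⟨r, hr⟩ := D.exists_coxeter_pow_not_nonneg o H hd
  exact hr (hpos r).2.le

end DualFamilies

end FinQuiver

/-! ### Reflection functors -/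

namespace QuiverRep

section ComplementarySubmodules

variable {R : Type*} [Ring R]

theorem isCompl_pi {ι : Type*} {M : ι → Type*} [∀ i, AddCommGroup (M i)] [∀ i, Module R (M i)]
    {U W : ∀ i, Submodule R (M i)} (h : ∀ i, IsCompl (U i) (W i)) :
    IsCompl (Submodule.pi Set.univ U) (Submodule.pi Set.univ W) := by
  constructor
  · rw [Submodule.disjoint_def]
    intro x hU hW
    ext i
    exact Submodule.disjoint_def.1 (h i).disjoint _ (hU i trivial) (hW i trivial)
  · rw [codisjoint_iff, Submodule.eq_top_iff']
    intro x
    have hx : ∀ i, ∃ u ∈ U i, ∃ w ∈ W i, u + w = x i := fun i =>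
      Submodule.mem_sup.1 ((h i).sup_eq_top ▸ Submodule.mem_top)
    choose u hu w hw huw using hx
    exact Submodule.mem_sup.2 ⟨u, fun i _ => hu i, w, fun i _ => hw i, funext huw⟩

variable {M N P : Type*} [AddCommGroup M] [Module R M] [AddCommGroup N] [Module R N]
  [AddCommGroup P] [Module R P]

theorem isCompl_comap_equiv (f : M ≃ₗ[R] N) {A B : Submodule R N} (h : IsCompl A B) :
    IsCompl (A.comap f.toLinearMap) (B.comap f.toLinearMap) :=
  (Submodule.orderIsoMapComap f).symm.isCompl h

theorem comap_equiv_eq_bot_iff (f : M ≃ₗ[R] N) {A : Submodule R N} :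
    A.comap f.toLinearMap = ⊥ ↔ A = ⊥ :=
  map_eq_bot_iff (Submodule.orderIsoMapComap f).symm

theorem isCompl_comap_of_exact {f : M →ₗ[R] N} {g : N →ₗ[R] P} (hf : LinearMap.ker f = ⊥)
    (hfg : Function.Exact f g) {A B : Submodule R N} (h : IsCompl A B) {A' B' : Submodule R P}
    (h' : Disjoint A' B') (hA : A ≤ A'.comap g) (hB : B ≤ B'.comap g) :
    IsCompl (A.comap f) (B.comap f) := by
  constructor
  · rw [disjoint_iff, ← Submodule.comap_inf, h.inf_eq_bot]
    exact hf
  · rw [codisjoint_iff, Submodule.eq_top_iff']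
    intro x
    obtain ⟨a, ha, b, hb, hab⟩ :=
      Submodule.mem_sup.1 (h.sup_eq_top ▸ Submodule.mem_top : f x ∈ A ⊔ B)
    have hg : g a + g b = 0 := by rw [← map_add, hab, hfg.apply_apply_eq_zero]
    have hga : g a = 0 := Submodule.disjoint_def.1 h' _ (hA ha)
      (eq_neg_of_add_eq_zero_left hg ▸ neg_mem (hB hb))
    obtain ⟨y, rfl⟩ := (hfg a).1 hga
    refine Submodule.mem_sup.2 ⟨y, ha, x - y, ?_, add_sub_cancel y x⟩
    rwa [Submodule.mem_comap, map_sub, ← hab, add_sub_cancel_left]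

theorem isCompl_map_of_exact {g : P →ₗ[R] M} {f : M →ₗ[R] N} (hf : LinearMap.range f = ⊤)
    (hgf : Function.Exact g f) {A B : Submodule R M} (h : IsCompl A B) {A' B' : Submodule R P}
    (h' : Codisjoint A' B') (hA : A' ≤ A.comap g) (hB : B' ≤ B.comap g) :
    IsCompl (A.map f) (B.map f) := by
  constructor
  · rw [Submodule.disjoint_def]
    rintro _ ⟨a, ha, rfl⟩ ⟨b, hb, hab⟩
    obtain ⟨c, hc⟩ := (hgf (a - b)).1 (by rw [map_sub, hab, sub_self])
    obtain ⟨a', ha', b', hb', rfl⟩ :=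
      Submodule.mem_sup.1 (h'.eq_top ▸ Submodule.mem_top : c ∈ A' ⊔ B')
    rw [map_add] at hc
    have hdiff : a - g a' = b + g b' := by
      rw [sub_eq_iff_eq_add, add_assoc, add_comm (g b'), hc, add_sub_cancel]
    have hzero : a - g a' = 0 := Submodule.disjoint_def.1 h.disjoint _ (sub_mem ha (hA ha'))
      (hdiff ▸ add_mem hb (hB hb'))
    rw [sub_eq_zero.1 hzero, hgf.apply_apply_eq_zero]
  · rw [codisjoint_iff, ← Submodule.map_sup, h.sup_eq_top, Submodule.map_top, hf]

end ComplementarySubmodules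

variable {V E : Type} {k : Type u} [Field k] {Q : FinQuiver V E}

theorem IsSubrep.map_castObj_mem {X : QuiverRep k Q} {U : ∀ i, Submodule k (X.obj i)}
    (hU : X.IsSubrep U) (e : E) {i j : V} (hi : i = Q.src e) (hj : Q.tgt e = j) {x : X.obj i}
    (hx : x ∈ U i) : X.castObj hj (X.map e (X.castObj hi x)) ∈ U j := by
  subst hi hj
  exact hU e x hx

section Indecomposable

variable [DecidableEq V]

theorem isCompl_update {X : QuiverRep k Q} {U W : ∀ i, Submodule k (X.obj i)}
    {i : V} {A B : Submodule k (X.obj i)} (hAB : IsCompl A B)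
    (h : ∀ j, j ≠ i → IsCompl (U j) (W j)) (j : V) :
    IsCompl (Function.update U i A j) (Function.update W i B j) := by
  rcases eq_or_ne j i with rfl | hj
  · simpa using hAB
  · simpa [hj] using h j hj

theorem dimVector_eq_single {X : QuiverRep k Q} {i : V} (hi : Module.finrank k (X.obj i) = 1)
    (h : ∀ j ≠ i, Subsingleton (X.obj j)) : X.dimVector = Pi.single i 1 := by
  ext j
  rcases eq_or_ne j i with rfl | hj
  · rw [Pi.single_eq_same, dimVector, hi, Nat.cast_one]
  · have := h j hj
    rw [Pi.single_eq_of_ne hj, dimVector, Module.finrank_zero_of_subsingleton, Nat.cast_zero]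

theorem Indecomposable.exists_ne_nontrivial {X : QuiverRep k Q} (hX : X.Indecomposable) {i : V}
    (hloop : ∀ e, Q.src e = i → Q.tgt e ≠ i) (hd : X.dimVector ≠ Pi.single i 1) :
    ∃ j ≠ i, Nontrivial (X.obj j) := by
  by_contra! h
  obtain ⟨j, hj⟩ := hX.1
  obtain rfl : j = i := by
    by_contra hji
    exact not_subsingleton_iff_nontrivial.2 hj (h j hji)
  have hsub : ∀ U, X.IsSubrep U := fun U e x _ => by
    rcases eq_or_ne (Q.src e) j with hs | hs
    · have := h _ (hloop e hs)
      exact Subsingleton.elim (0 : X.obj (Q.tgt e)) (X.map e x) ▸ zero_mem _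
    · have := h _ hs
      rw [Subsingleton.elim x 0, map_zero]
      exact zero_mem _
  obtain ⟨v, hv⟩ := exists_ne (0 : X.obj j)
  obtain ⟨L, hL⟩ := Submodule.exists_isCompl (Submodule.span k {v})
  have hbot : L = ⊥ := by
    rcases hX.2 _ _ (hsub (Function.update (fun _ => ⊥) j (Submodule.span k {v})))
      (hsub (Function.update (fun _ => ⊤) j L))
      (isCompl_update hL fun _ _ => isCompl_bot_top) with h' | h'
    · exact absurd (by simpa using h' j) hv
    · simpa using h' j
  refine hd (dimVector_eq_single ?_ h)
  rw [← finrank_top, ← hL.sup_eq_top, hbot, sup_bot_eq, finrank_span_singleton hv]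

theorem Indecomposable.eq_bot_of_isCompl {X : QuiverRep k Q} (hX : X.Indecomposable) {i : V}
    (hloop : ∀ e, Q.src e = i → Q.tgt e ≠ i) (hd : X.dimVector ≠ Pi.single i 1)
    {A B : Submodule k (X.obj i)} (hAB : IsCompl A B)
    (hA : X.IsSubrep (Function.update (fun _ => ⊥) i A))
    (hB : X.IsSubrep (Function.update (fun _ => ⊤) i B)) : A = ⊥ := by
  rcases hX.2 _ _ hA hB (isCompl_update hAB fun _ _ => isCompl_bot_top) with h | h
  · simpa using h i
  · obtain ⟨j, hj, hnt⟩ := hX.exists_ne_nontrivial hloop hd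
    exact absurd (by simpa [hj] using h j) (top_ne_bot (α := Submodule k (X.obj j)))

end Indecomposable

section Minus

theorem outMap_apply (X : QuiverRep k Q) {e : E} (x : X.obj (Q.src e)) :
    X.outMap (Q.src e) x ⟨e, rfl⟩ = X.map e x := rfl

variable [DecidableEq V]

theorem Indecomposable.ker_outMap {X : QuiverRep k Q} (hX : X.Indecomposable) {i : V}
    (hi : Q.IsSource i) (hd : X.dimVector ≠ Pi.single i 1) :
    LinearMap.ker (X.outMap i) = ⊥ := by
  obtain ⟨L, hL⟩ := Submodule.exists_isCompl (LinearMap.ker (X.outMap i))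
  refine hX.eq_bot_of_isCompl (fun e _ => hi e) hd hL (fun e x hx => ?_) fun e x _ => ?_
  · rw [Function.update_of_ne (hi e), Submodule.mem_bot]
    rcases eq_or_ne (Q.src e) i with rfl | hs
    · rw [Function.update_self, LinearMap.mem_ker] at hx
      rw [← outMap_apply, hx, Pi.zero_apply]
    · rw [Function.update_of_ne hs, Submodule.mem_bot] at hx
      rw [hx, map_zero]
  · rw [Function.update_of_ne (hi e)]
    trivial

variable [DecidableEq E] (X : QuiverRep k Q) (i : V)

/-- The identification of `X_j` with `(S_i^- X)_j`, for `j ≠ i`. -/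
def minusEquiv {j : V} (h : j ≠ i) : X.obj j ≃ₗ[k] (X.reflMinus i).obj j :=
  (Pick.negEquiv (decEq j i) k h).symm

/-- The identification of the cokernel of `outMap` with `(S_i^- X)_i`. -/
def minusEquivSelf :
    (((e : {e : E // Q.src e = i}) → X.obj (Q.tgt e)) ⧸ LinearMap.range (X.outMap i)) ≃ₗ[k]
      (X.reflMinus i).obj i :=
  (Pick.posEquiv (decEq i i) k rfl).symm

theorem castObj_minusEquiv {a b : V} (h : a = b) (ha : a ≠ i) (hb : b ≠ i) (x : X.obj b) :
    X.castObj h ((Pick.negEquiv (decEq a i) k ha : X.minusObj i a ≃ₗ[k] X.obj a)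
      ((X.reflMinus i).castObj h.symm (X.minusEquiv i hb x))) = x := by
  subst h
  exact (Pick.negEquiv (decEq a i) k ha : X.minusObj i a ≃ₗ[k] X.obj a).apply_symm_apply x

theorem castObj_negEquiv_symm_minus {a b : V} (h : a = b) (ha : a ≠ i) (hb : b ≠ i)
    (x : X.obj b) : (X.reflMinus i).castObj h
      ((Pick.negEquiv (decEq a i) k ha).symm (X.castObj h.symm x)) = X.minusEquiv i hb x := by
  subst h
  rfl

theorem castObj_posEquiv_symm_minus {a : V} (h : a = i)
    (x : ((e : {e : E // Q.src e = i}) → X.obj (Q.tgt e)) ⧸ LinearMap.range (X.outMap i)) :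
    (X.reflMinus i).castObj h ((Pick.posEquiv (decEq a i) k h).symm x) =
      X.minusEquivSelf i x := by
  subst h
  rfl

theorem reflMinus_map_minusEquiv {e : E} (hs : Q.src e ≠ i) (ht : Q.tgt e ≠ i)
    (h₁ : Q.src e = (Q.reflect i).src e) (h₂ : (Q.reflect i).tgt e = Q.tgt e)
    (x : X.obj (Q.src e)) :
    (X.reflMinus i).castObj h₂
        ((X.reflMinus i).map e ((X.reflMinus i).castObj h₁ (X.minusEquiv i hs x))) =
      X.minusEquiv i ht (X.map e x) := by
  have hmap : (X.reflMinus i).map e = _ := (dif_neg ht).trans (dif_neg hs)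
  rw [← castObj_negEquiv_symm_minus X i h₂ (h₂.trans_ne ht) ht]
  refine congrArg _ ((LinearMap.congr_fun hmap _).trans ?_)
  exact congrArg (fun y => (Pick.negEquiv _ k (h₂.trans_ne ht)).symm
    (X.castObj h₂.symm (X.map e y))) (X.castObj_minusEquiv i h₁.symm (h₁.symm.trans_ne hs) hs x)

theorem reflMinus_map_minusEquiv_of_src_eq {e : E} (hs : Q.src e = i) (ht : Q.tgt e ≠ i)
    (h₁ : Q.tgt e = (Q.reflect i).src e) (h₂ : (Q.reflect i).tgt e = i) (x : X.obj (Q.tgt e)) :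
    (X.reflMinus i).castObj h₂
        ((X.reflMinus i).map e ((X.reflMinus i).castObj h₁ (X.minusEquiv i ht x))) =
      X.minusEquivSelf i ((LinearMap.range (X.outMap i)).mkQ
        (Pi.single (M := fun e : {e : E // Q.src e = i} => X.obj (Q.tgt e)) ⟨e, hs⟩ x)) := by
  have hmap : (X.reflMinus i).map e = _ := (dif_neg ht).trans (dif_pos hs)
  rw [← castObj_posEquiv_symm_minus X i h₂]
  refine congrArg _ ((LinearMap.congr_fun hmap _).trans ?_)
  exact congrArg (fun y => (Pick.posEquiv _ k h₂).symm ((LinearMap.range (X.outMap i)).mkQ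
    (Pi.single (M := fun e : {e : E // Q.src e = i} => X.obj (Q.tgt e)) ⟨e, hs⟩ y)))
    (X.castObj_minusEquiv i h₁.symm (h₁.symm.trans_ne ht) ht x)

variable {X i}

theorem IsSubrep.minusEquiv_map_mem {U : ∀ j, Submodule k ((X.reflMinus i).obj j)}
    (hU : (X.reflMinus i).IsSubrep U) {e : E} (hs : Q.src e ≠ i) (ht : Q.tgt e ≠ i)
    {x : X.obj (Q.src e)} (hx : X.minusEquiv i hs x ∈ U (Q.src e)) :
    X.minusEquiv i ht (X.map e x) ∈ U (Q.tgt e) := by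
  have h₁ : (Q.reflect i).src e = Q.src e := by simp [FinQuiver.reflect, hs, ht]
  have h₂ : (Q.reflect i).tgt e = Q.tgt e := by simp [FinQuiver.reflect, hs, ht]
  exact X.reflMinus_map_minusEquiv i hs ht h₁.symm h₂ x ▸ hU.map_castObj_mem e h₁.symm h₂ hx

theorem IsSubrep.minusEquivSelf_single_mem {U : ∀ j, Submodule k ((X.reflMinus i).obj j)}
    (hU : (X.reflMinus i).IsSubrep U) (e : {e : E // Q.src e = i}) (ht : Q.tgt e ≠ i)
    {x : X.obj (Q.tgt e)} (hx : X.minusEquiv i ht x ∈ U (Q.tgt e)) :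
    X.minusEquivSelf i ((LinearMap.range (X.outMap i)).mkQ (Pi.single e x)) ∈ U i := by
  obtain ⟨e, hs⟩ := e
  have h₁ : (Q.reflect i).src e = Q.tgt e := by simp [FinQuiver.reflect, hs]
  have h₂ : (Q.reflect i).tgt e = i := by simp [FinQuiver.reflect, hs]
  exact X.reflMinus_map_minusEquiv_of_src_eq i hs ht h₁.symm h₂ x ▸
    hU.map_castObj_mem e h₁.symm h₂ hx

/-- For a source `i` and a family `U` of subspaces of `S_i^- X`, the sum of the `U_{t(α)}` over the
arrows `α` starting at `i`, as a subspace of `⨁_{s(α) = i} X_{t(α)}`. -/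
def minusSum (hi : Q.IsSource i) (U : ∀ j, Submodule k ((X.reflMinus i).obj j)) :
    Submodule k ((e : {e : E // Q.src e = i}) → X.obj (Q.tgt e)) :=
  Submodule.pi Set.univ fun e => (U (Q.tgt e)).comap (X.minusEquiv i (hi e)).toLinearMap

theorem isCompl_minusSum (hi : Q.IsSource i) {U W : ∀ j, Submodule k ((X.reflMinus i).obj j)}
    (h : ∀ j, IsCompl (U j) (W j)) : IsCompl (minusSum hi U) (minusSum hi W) :=
  isCompl_pi fun _ => isCompl_comap_equiv _ (h _)

theorem IsSubrep.minusSum_le [Finite E] (hi : Q.IsSource i)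
    {U : ∀ j, Submodule k ((X.reflMinus i).obj j)} (hU : (X.reflMinus i).IsSubrep U) :
    minusSum hi U ≤ ((U i).comap (X.minusEquivSelf i).toLinearMap).comap
      (LinearMap.range (X.outMap i)).mkQ := by
  intro v hv
  cases nonempty_fintype E
  rw [← Finset.univ_sum_single v]
  exact Submodule.sum_mem _ fun e _ => hU.minusEquivSelf_single_mem e (hi e) (hv e trivial)

/-- The family of subspaces of `X` induced by a family `U` of subspaces of `S_i^- X`, for a
source `i`: at `i`, the elements all of whose images under the arrows lie in `U`. -/
def minusLift (hi : Q.IsSource i) (U : ∀ j, Submodule k ((X.reflMinus i).obj j)) (j : V) :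
    Submodule k (X.obj j) :=
  if h : j = i then ((minusSum hi U).comap (X.outMap i)).comap (X.castObj h).toLinearMap
  else (U j).comap (X.minusEquiv i h).toLinearMap

theorem minusLift_self (hi : Q.IsSource i) (U : ∀ j, Submodule k ((X.reflMinus i).obj j)) :
    minusLift hi U i = (minusSum hi U).comap (X.outMap i) := dif_pos rfl

theorem minusLift_of_ne (hi : Q.IsSource i) (U : ∀ j, Submodule k ((X.reflMinus i).obj j))
    {j : V} (hj : j ≠ i) : minusLift hi U j = (U j).comap (X.minusEquiv i hj).toLinearMap :=
  dif_neg hj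

theorem IsSubrep.minusLift (hi : Q.IsSource i) {U : ∀ j, Submodule k ((X.reflMinus i).obj j)}
    (hU : (X.reflMinus i).IsSubrep U) : X.IsSubrep (minusLift hi U) := by
  intro e x hx
  rw [minusLift_of_ne hi U (hi e)]
  rcases eq_or_ne (Q.src e) i with rfl | hs
  · rw [minusLift_self] at hx
    exact hx ⟨e, rfl⟩ trivial
  · rw [minusLift_of_ne hi U hs] at hx
    exact hU.minusEquiv_map_mem hs (hi e) hx

theorem isCompl_minusLift [Finite E] (hker : LinearMap.ker (X.outMap i) = ⊥)
    (hi : Q.IsSource i) {U W : ∀ j, Submodule k ((X.reflMinus i).obj j)}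
    (hU : (X.reflMinus i).IsSubrep U) (hW : (X.reflMinus i).IsSubrep W)
    (hUW : ∀ j, IsCompl (U j) (W j)) (j : V) : IsCompl (minusLift hi U j) (minusLift hi W j) := by
  rcases eq_or_ne j i with rfl | hj
  · rw [minusLift_self, minusLift_self]
    exact isCompl_comap_of_exact hker (LinearMap.exact_map_mkQ_range _)
      (isCompl_minusSum hi hUW) (isCompl_comap_equiv _ (hUW j)).disjoint (hU.minusSum_le hi)
      (hW.minusSum_le hi)
  · rw [minusLift_of_ne hi U hj, minusLift_of_ne hi W hj]
    exact isCompl_comap_equiv _ (hUW j)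

theorem eq_bot_of_minusLift_eq_bot [Finite E] (hi : Q.IsSource i)
    {U W : ∀ j, Submodule k ((X.reflMinus i).obj j)} (hW : (X.reflMinus i).IsSubrep W)
    (hUW : ∀ j, IsCompl (U j) (W j)) (h : ∀ j, minusLift hi U j = ⊥) (j : V) : U j = ⊥ := by
  have hne : ∀ j ≠ i, U j = ⊥ := fun j hj => by
    rw [← comap_equiv_eq_bot_iff (X.minusEquiv i hj), ← minusLift_of_ne hi U hj, h]
  rcases eq_or_ne j i with rfl | hj
  · rw [← (hUW j).disjoint.eq_bot, left_eq_inf]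
    intro y _
    obtain ⟨y, rfl⟩ := (X.minusEquivSelf j).surjective y
    obtain ⟨v, rfl⟩ := Submodule.mkQ_surjective _ y
    refine hW.minusSum_le hi fun e _ => ?_
    have htop : W (Q.tgt e) = ⊤ := by
      rw [← (hUW _).sup_eq_top, hne _ (hi e), bot_sup_eq]
    exact (htop ▸ Submodule.mem_top : X.minusEquiv _ (hi e) (v e) ∈ W (Q.tgt e))
  · exact hne j hj

theorem Indecomposable.reflMinus [Finite E] (hX : X.Indecomposable) (hi : Q.IsSource i)
    (hd : X.dimVector ≠ Pi.single i 1) : (X.reflMinus i).Indecomposable := by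
  refine ⟨?_, fun U W hU hW hUW => ?_⟩
  · obtain ⟨j, hj, hnt⟩ := hX.exists_ne_nontrivial (fun e _ => hi e) hd
    exact ⟨j, (X.minusEquiv i hj).symm.toEquiv.nontrivial⟩
  · exact (hX.2 _ _ (hU.minusLift hi) (hW.minusLift hi)
      (isCompl_minusLift (hX.ker_outMap hi hd) hi hU hW hUW)).imp
      (eq_bot_of_minusLift_eq_bot hi hW hUW)
      (eq_bot_of_minusLift_eq_bot hi hU fun j => (hUW j).symm)

theorem IsFiniteDimensional.reflMinus [Finite E] (hX : X.IsFiniteDimensional) :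
    (X.reflMinus i).IsFiniteDimensional := fun j => by
  have : ∀ j, FiniteDimensional k (X.obj j) := hX
  rcases eq_or_ne j i with rfl | hj
  · exact (X.minusEquivSelf j).finiteDimensional
  · exact (X.minusEquiv i hj).finiteDimensional

theorem Indecomposable.dimVector_reflMinus [Fintype V] [Fintype E] (hX : X.Indecomposable)
    (hf : X.IsFiniteDimensional) (hi : Q.IsSource i) (hd : X.dimVector ≠ Pi.single i 1) :
    (X.reflMinus i).dimVector = Q.reflection i X.dimVector := by
  have : ∀ j, FiniteDimensional k (X.obj j) := hf
  ext j
  rcases eq_or_ne j i with rfl | hj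
  · have hdim := (LinearMap.range (X.outMap j)).finrank_quotient_add_finrank
    rw [LinearMap.finrank_range_of_inj (LinearMap.ker_eq_bot.1 (hX.ker_outMap hi hd)),
      Module.finrank_pi_fintype, (X.minusEquivSelf j).finrank_eq] at hdim
    simp only [hi.reflection_apply_source, dimVector]
    exact eq_sub_of_add_eq (mod_cast hdim)
  · rw [Q.reflection_apply_of_ne hj, dimVector, dimVector, (X.minusEquiv i hj).finrank_eq]

end Minus

section Plus

variable [DecidableEq V] [Fintype E]

theorem inMap_apply (X : QuiverRep k Q) (i : V)
    (v : (e : {e : E // Q.tgt e = i}) → X.obj (Q.src e)) :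
    X.inMap i v = ∑ e : {e : E // Q.tgt e = i}, X.castObj e.2 (X.map e (v e)) := by
  simp [inMap]

theorem inMap_single [DecidableEq E] (X : QuiverRep k Q) (e : E) (x : X.obj (Q.src e)) :
    X.inMap (Q.tgt e) (Pi.single (M := fun e' : {e' : E // Q.tgt e' = Q.tgt e} =>
      X.obj (Q.src e')) ⟨e, rfl⟩ x) = X.map e x := by
  rw [inMap_apply, Finset.sum_eq_single ⟨e, rfl⟩]
  · rw [Pi.single_eq_same]
    rfl
  · intro e' _ he'
    rw [Pi.single_eq_of_ne he', map_zero, map_zero]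
  · simp

theorem Indecomposable.range_inMap {X : QuiverRep k Q} (hX : X.Indecomposable) {i : V}
    (hi : Q.IsSink i) (hd : X.dimVector ≠ Pi.single i 1) : LinearMap.range (X.inMap i) = ⊤ := by
  classical
  obtain ⟨L, hL⟩ := Submodule.exists_isCompl (LinearMap.range (X.inMap i))
  have hbot : L = ⊥ := by
    refine hX.eq_bot_of_isCompl (fun e he => absurd he (hi e)) hd hL.symm
      (fun e x hx => ?_) fun e x _ => ?_
    · rw [Function.update_of_ne (hi e), Submodule.mem_bot] at hx
      rw [hx, map_zero]
      exact zero_mem _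
    · rcases eq_or_ne (Q.tgt e) i with rfl | ht
      · rw [Function.update_self, ← inMap_single]
        exact LinearMap.mem_range_self _ _
      · rw [Function.update_of_ne ht]
        trivial
  rw [← hL.sup_eq_top, hbot, sup_bot_eq]

variable (X : QuiverRep k Q) (i : V)

/-- The identification of `X_j` with `(S_i^+ X)_j`, for `j ≠ i`. -/
def plusEquiv {j : V} (h : j ≠ i) : X.obj j ≃ₗ[k] (X.reflPlus i).obj j :=
  (Pick.negEquiv (decEq j i) k h).symm

/-- The identification of the kernel of `inMap` with `(S_i^+ X)_i`. -/
def plusEquivSelf : LinearMap.ker (X.inMap i) ≃ₗ[k] (X.reflPlus i).obj i :=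
  (Pick.posEquiv (decEq i i) k rfl).symm

theorem castObj_plusEquiv {a b : V} (h : a = b) (ha : a ≠ i) (hb : b ≠ i) (x : X.obj b) :
    X.castObj h ((Pick.negEquiv (decEq a i) k ha : X.plusObj i a ≃ₗ[k] X.obj a)
      ((X.reflPlus i).castObj h.symm (X.plusEquiv i hb x))) = x := by
  subst h
  exact (Pick.negEquiv (decEq a i) k ha : X.plusObj i a ≃ₗ[k] X.obj a).apply_symm_apply x

theorem castObj_negEquiv_symm_plus {a b : V} (h : a = b) (ha : a ≠ i) (hb : b ≠ i)
    (x : X.obj b) : (X.reflPlus i).castObj h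
      ((Pick.negEquiv (decEq a i) k ha).symm (X.castObj h.symm x)) = X.plusEquiv i hb x := by
  subst h
  rfl

theorem posEquiv_plusEquivSelf {a : V} (h : a = i) (x : LinearMap.ker (X.inMap i)) :
    (Pick.posEquiv (decEq a i) k h : X.plusObj i a ≃ₗ[k] _)
      ((X.reflPlus i).castObj h.symm (X.plusEquivSelf i x)) = x := by
  subst h
  exact (Pick.posEquiv (decEq a a) k rfl : X.plusObj a a ≃ₗ[k] _).apply_symm_apply x

theorem reflPlus_map_plusEquiv {e : E} (hs : Q.src e ≠ i) (ht : Q.tgt e ≠ i)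
    (h₁ : Q.src e = (Q.reflect i).src e) (h₂ : (Q.reflect i).tgt e = Q.tgt e)
    (x : X.obj (Q.src e)) :
    (X.reflPlus i).castObj h₂
        ((X.reflPlus i).map e ((X.reflPlus i).castObj h₁ (X.plusEquiv i hs x))) =
      X.plusEquiv i ht (X.map e x) := by
  have hmap : (X.reflPlus i).map e = _ := (dif_neg hs).trans (dif_neg ht)
  rw [← castObj_negEquiv_symm_plus X i h₂ (h₂.trans_ne ht) ht]
  refine congrArg _ ((LinearMap.congr_fun hmap _).trans ?_)
  exact congrArg (fun y => (Pick.negEquiv _ k (h₂.trans_ne ht)).symm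
    (X.castObj h₂.symm (X.map e y))) (X.castObj_plusEquiv i h₁.symm (h₁.symm.trans_ne hs) hs x)

theorem reflPlus_map_plusEquivSelf {e : E} (hs : Q.src e ≠ i) (ht : Q.tgt e = i)
    (h₁ : i = (Q.reflect i).src e) (h₂ : (Q.reflect i).tgt e = Q.src e)
    (v : LinearMap.ker (X.inMap i)) :
    (X.reflPlus i).castObj h₂
        ((X.reflPlus i).map e ((X.reflPlus i).castObj h₁ (X.plusEquivSelf i v))) =
      X.plusEquiv i hs (v.1 ⟨e, ht⟩) := by
  have hmap : (X.reflPlus i).map e = _ := (dif_neg hs).trans (dif_pos ht)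
  rw [← castObj_negEquiv_symm_plus X i h₂ (h₂.trans_ne hs) hs]
  refine congrArg _ ((LinearMap.congr_fun hmap _).trans ?_)
  exact congrArg (fun w : LinearMap.ker (X.inMap i) => (Pick.negEquiv _ k (h₂.trans_ne hs)).symm
    (X.castObj h₂.symm (w.1 ⟨e, ht⟩))) (X.posEquiv_plusEquivSelf i h₁.symm v)

variable {X i}

theorem IsSubrep.plusEquiv_map_mem {U : ∀ j, Submodule k ((X.reflPlus i).obj j)}
    (hU : (X.reflPlus i).IsSubrep U) {e : E} (hs : Q.src e ≠ i) (ht : Q.tgt e ≠ i)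
    {x : X.obj (Q.src e)} (hx : X.plusEquiv i hs x ∈ U (Q.src e)) :
    X.plusEquiv i ht (X.map e x) ∈ U (Q.tgt e) := by
  have h₁ : (Q.reflect i).src e = Q.src e := by simp [FinQuiver.reflect, hs, ht]
  have h₂ : (Q.reflect i).tgt e = Q.tgt e := by simp [FinQuiver.reflect, hs, ht]
  exact X.reflPlus_map_plusEquiv i hs ht h₁.symm h₂ x ▸ hU.map_castObj_mem e h₁.symm h₂ hx

/-- For a sink `i` and a family `U` of subspaces of `S_i^+ X`, the sum of the `U_{s(α)}` over the
arrows `α` ending at `i`, as a subspace of `⨁_{t(α) = i} X_{s(α)}`. -/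
def plusSum (hi : Q.IsSink i) (U : ∀ j, Submodule k ((X.reflPlus i).obj j)) :
    Submodule k ((e : {e : E // Q.tgt e = i}) → X.obj (Q.src e)) :=
  Submodule.pi Set.univ fun e => (U (Q.src e)).comap (X.plusEquiv i (hi e)).toLinearMap

theorem isCompl_plusSum (hi : Q.IsSink i) {U W : ∀ j, Submodule k ((X.reflPlus i).obj j)}
    (h : ∀ j, IsCompl (U j) (W j)) : IsCompl (plusSum hi U) (plusSum hi W) :=
  isCompl_pi fun _ => isCompl_comap_equiv _ (h _)

theorem IsSubrep.le_plusSum (hi : Q.IsSink i) {U : ∀ j, Submodule k ((X.reflPlus i).obj j)}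
    (hU : (X.reflPlus i).IsSubrep U) :
    (U i).comap (X.plusEquivSelf i).toLinearMap ≤
      (plusSum hi U).comap (LinearMap.ker (X.inMap i)).subtype := by
  rintro v hv ⟨e, ht⟩ -
  have h₁ : (Q.reflect i).src e = i := by simp [FinQuiver.reflect, ht]
  have h₂ : (Q.reflect i).tgt e = Q.src e := by simp [FinQuiver.reflect, ht]
  have hmem := hU.map_castObj_mem e h₁.symm h₂ hv
  rwa [LinearEquiv.coe_coe, X.reflPlus_map_plusEquivSelf i (hi e) ht] at hmem

/-- The family of subspaces of `X` induced by a family `U` of subspaces of `S_i^+ X`, for a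
sink `i`: at `i`, the sum of the images of the subspaces `U_j` under the arrows. -/
def plusLift (hi : Q.IsSink i) (U : ∀ j, Submodule k ((X.reflPlus i).obj j)) (j : V) :
    Submodule k (X.obj j) :=
  if h : j = i then ((plusSum hi U).map (X.inMap i)).comap (X.castObj h).toLinearMap
  else (U j).comap (X.plusEquiv i h).toLinearMap

theorem plusLift_self (hi : Q.IsSink i) (U : ∀ j, Submodule k ((X.reflPlus i).obj j)) :
    plusLift hi U i = (plusSum hi U).map (X.inMap i) := dif_pos rfl

theorem plusLift_of_ne (hi : Q.IsSink i) (U : ∀ j, Submodule k ((X.reflPlus i).obj j))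
    {j : V} (hj : j ≠ i) : plusLift hi U j = (U j).comap (X.plusEquiv i hj).toLinearMap :=
  dif_neg hj

theorem IsSubrep.plusLift (hi : Q.IsSink i) {U : ∀ j, Submodule k ((X.reflPlus i).obj j)}
    (hU : (X.reflPlus i).IsSubrep U) : X.IsSubrep (plusLift hi U) := by
  classical
  intro e x hx
  rw [plusLift_of_ne hi U (hi e)] at hx
  rcases eq_or_ne (Q.tgt e) i with rfl | ht
  · rw [plusLift_self]
    refine ⟨_, fun e' _ => ?_, X.inMap_single e x⟩
    rcases eq_or_ne e' ⟨e, rfl⟩ with rfl | he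
    · rw [Pi.single_eq_same]
      exact hx
    · rw [Pi.single_eq_of_ne he]
      exact zero_mem _
  · rw [plusLift_of_ne hi U ht]
    exact hU.plusEquiv_map_mem (hi e) ht hx

theorem isCompl_plusLift (hrange : LinearMap.range (X.inMap i) = ⊤) (hi : Q.IsSink i)
    {U W : ∀ j, Submodule k ((X.reflPlus i).obj j)} (hU : (X.reflPlus i).IsSubrep U)
    (hW : (X.reflPlus i).IsSubrep W) (hUW : ∀ j, IsCompl (U j) (W j)) (j : V) :
    IsCompl (plusLift hi U j) (plusLift hi W j) := by
  rcases eq_or_ne j i with rfl | hj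
  · rw [plusLift_self, plusLift_self]
    exact isCompl_map_of_exact hrange (LinearMap.exact_subtype_ker_map _)
      (isCompl_plusSum hi hUW) (isCompl_comap_equiv _ (hUW j)).codisjoint (hU.le_plusSum hi)
      (hW.le_plusSum hi)
  · rw [plusLift_of_ne hi U hj, plusLift_of_ne hi W hj]
    exact isCompl_comap_equiv _ (hUW j)

theorem eq_bot_of_plusLift_eq_bot (hi : Q.IsSink i)
    {U : ∀ j, Submodule k ((X.reflPlus i).obj j)} (hU : (X.reflPlus i).IsSubrep U)
    (h : ∀ j, plusLift hi U j = ⊥) (j : V) : U j = ⊥ := by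
  have hne : ∀ j ≠ i, U j = ⊥ := fun j hj => by
    rw [← comap_equiv_eq_bot_iff (X.plusEquiv i hj), ← plusLift_of_ne hi U hj, h]
  rcases eq_or_ne j i with rfl | hj
  · rw [← comap_equiv_eq_bot_iff (X.plusEquivSelf j), Submodule.eq_bot_iff]
    refine fun v hv => Subtype.ext (funext fun e => ?_)
    have hmem : X.plusEquiv _ (hi e) (v.1 e) ∈ U (Q.src e) := hU.le_plusSum hi hv e trivial
    rwa [hne _ (hi e), Submodule.mem_bot, LinearEquiv.map_eq_zero_iff] at hmem
  · exact hne j hj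

theorem Indecomposable.reflPlus (hX : X.Indecomposable) (hi : Q.IsSink i)
    (hd : X.dimVector ≠ Pi.single i 1) : (X.reflPlus i).Indecomposable := by
  refine ⟨?_, fun U W hU hW hUW => ?_⟩
  · obtain ⟨j, hj, hnt⟩ := hX.exists_ne_nontrivial (fun e he => absurd he (hi e)) hd
    exact ⟨j, (X.plusEquiv i hj).symm.toEquiv.nontrivial⟩
  · exact (hX.2 _ _ (hU.plusLift hi) (hW.plusLift hi)
      (isCompl_plusLift (hX.range_inMap hi hd) hi hU hW hUW)).imp
      (eq_bot_of_plusLift_eq_bot hi hU) (eq_bot_of_plusLift_eq_bot hi hW)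

theorem IsFiniteDimensional.reflPlus (hX : X.IsFiniteDimensional) :
    (X.reflPlus i).IsFiniteDimensional := fun j => by
  have : ∀ j, FiniteDimensional k (X.obj j) := hX
  rcases eq_or_ne j i with rfl | hj
  · exact (X.plusEquivSelf j).finiteDimensional
  · exact (X.plusEquiv i hj).finiteDimensional

theorem Indecomposable.dimVector_reflPlus [Fintype V] (hX : X.Indecomposable)
    (hf : X.IsFiniteDimensional) (hi : Q.IsSink i) (hd : X.dimVector ≠ Pi.single i 1) :
    (X.reflPlus i).dimVector = Q.reflection i X.dimVector := by
  have : ∀ j, FiniteDimensional k (X.obj j) := hf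
  ext j
  rcases eq_or_ne j i with rfl | hj
  · have hdim := (X.inMap j).finrank_range_add_finrank_ker
    rw [hX.range_inMap hi hd, finrank_top, Module.finrank_pi_fintype,
      (X.plusEquivSelf j).finrank_eq] at hdim
    simp only [hi.reflection_apply_sink, dimVector]
    exact eq_sub_of_add_eq' (mod_cast hdim)
  · rw [Q.reflection_apply_of_ne hj, dimVector, dimVector, (X.plusEquiv i hj).finrank_eq]

end Plus

section Coxeter

/-- A finite dimensional indecomposable representation with dimension vector `x`. -/
structure IsIndecOfDim (X : QuiverRep k Q) (x : V → ℤ) : Prop where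
  indecomposable : X.Indecomposable
  finiteDimensional : X.IsFiniteDimensional
  dimVector_eq : X.dimVector = x

theorem IsIndecOfDim.castQuiver {Q' : FinQuiver V E} (h : Q = Q') {X : QuiverRep k Q}
    {x : V → ℤ} (hX : X.IsIndecOfDim x) : (castQuiver h X).IsIndecOfDim x := by
  subst h
  exact hX

variable [Fintype V] [DecidableEq V] [Fintype E]

theorem IsIndecOfDim.plusList {X : QuiverRep k Q} {x : V → ℤ} (hX : X.IsIndecOfDim x)
    {l : List V} (hl : Q.SinkSequence l) (ha : Q.AvoidsSimple l x) :
    (X.plusList l).IsIndecOfDim (Q.reflectionList l x) := by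
  induction l generalizing Q x with
  | nil => exact hX
  | cons i l ih =>
    obtain ⟨hind, hfin, rfl⟩ := hX
    have h := ih (X := X.reflPlus i) (x := Q.reflection i X.dimVector)
      ⟨hind.reflPlus hl.1 ha.1, hfin.reflPlus, hind.dimVector_reflPlus hfin hl.1 ha.1⟩ hl.2
      ((FinQuiver.avoidsSimple_congr (Q.reflection_reflect i) l _).2 ha.2)
    rw [FinQuiver.reflectionList_reflect] at h
    rw [FinQuiver.reflectionList_cons]
    exact h

theorem IsIndecOfDim.iterate_coxPlus {o : Q.AdmissibleOrdering} {X : QuiverRep k Q}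
    {x : V → ℤ} (hX : X.IsIndecOfDim x)
    (ha : ∀ r, Q.AvoidsSimple o.list ((o.coxeter ^ r) x)) (r : ℕ) :
    ((coxPlus o)^[r] X).IsIndecOfDim ((o.coxeter ^ r) x) := by
  induction r with
  | zero => exact hX
  | succ r ih =>
    rw [Function.iterate_succ_apply', pow_succ']
    exact (ih.plusList o.sinks (ha r)).castQuiver _

variable [DecidableEq E]

theorem IsIndecOfDim.minusList {X : QuiverRep k Q} {x : V → ℤ} (hX : X.IsIndecOfDim x)
    {l : List V} (hl : Q.op.SinkSequence l) (ha : Q.AvoidsSimple l x) :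
    (X.minusList l).IsIndecOfDim (Q.reflectionList l x) := by
  induction l generalizing Q x with
  | nil => exact hX
  | cons i l ih =>
    obtain ⟨hind, hfin, rfl⟩ := hX
    obtain ⟨hi, hl⟩ := hl
    rw [FinQuiver.op_reflect] at hl
    have h := ih (X := X.reflMinus i) (x := Q.reflection i X.dimVector)
      ⟨hind.reflMinus hi ha.1, hfin.reflMinus, hind.dimVector_reflMinus hfin hi ha.1⟩ hl
      ((FinQuiver.avoidsSimple_congr (Q.reflection_reflect i) l _).2 ha.2)
    rw [FinQuiver.reflectionList_reflect] at h
    rw [FinQuiver.reflectionList_cons]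
    exact h

theorem IsIndecOfDim.iterate_coxMinus {o : Q.AdmissibleOrdering} {X : QuiverRep k Q}
    {x : V → ℤ} (hX : X.IsIndecOfDim x)
    (ha : ∀ r, Q.op.AvoidsSimple o.op.list ((o.op.coxeter ^ r) x)) (r : ℕ) :
    ((coxMinus o)^[r] X).IsIndecOfDim ((o.op.coxeter ^ r) x) := by
  induction r with
  | zero => exact hX
  | succ r ih =>
    have havoid := (FinQuiver.avoidsSimple_congr Q.reflection_op o.op.list _).1 (ha r)
    have hstep := (ih.minusList o.op.sinks havoid).castQuiver
      (Q.reflectList_eq_self o.op.list o.op.nodup o.op.mem)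
    rw [← FinQuiver.reflectionList_op] at hstep
    rw [Function.iterate_succ_apply', pow_succ']
    exact hstep

end Coxeter

end QuiverRep

/-! ### Projective and injective representations -/

namespace FinQuiver

variable {V E : Type} {Q : FinQuiver V E}

/-- The last arrow of a path, if the path is not trivial. -/
noncomputable def Path.lastArrow (Q : FinQuiver V E) {a b : V} (p : Q.Path a b) : Option E :=
  @Quiver.Path.rec V Q.toQuiver a (fun _ _ => Option E) none (fun _ e _ => some e.1) b p

/-- The decomposition of paths from `a` to `b` according to their last arrow: such a path is
trivial, or it prolongs a path from `a` by an arrow that ends at `b`. -/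
def Path.ofSum (Q : FinQuiver V E) (a b : V) :
    PLift (a = b) ⊕ (Σ e : {e : E // Q.tgt e = b}, Q.Path a (Q.src e)) → Q.Path a b
  | Sum.inl h => h.down ▸ @Quiver.Path.nil V Q.toQuiver a
  | Sum.inr ⟨e, p⟩ => @Quiver.Path.cons V Q.toQuiver a (Q.src e) b p ⟨e, rfl, e.2⟩

theorem Path.ofSum_bijective (Q : FinQuiver V E) (a b : V) :
    Function.Bijective (Path.ofSum Q a b) := by
  have hnil (h : PLift (a = b)) : Path.lastArrow Q (Path.ofSum Q a b (Sum.inl h)) = none := by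
    obtain ⟨rfl⟩ := h
    rfl
  have hcons (e : {e : E // Q.tgt e = b}) (p : Q.Path a (Q.src e)) :
      Path.lastArrow Q (Path.ofSum Q a b (Sum.inr ⟨e, p⟩)) = some e.1 := rfl
  constructor
  · rintro (h | ⟨⟨e, he⟩, p⟩) (h' | ⟨⟨e', he'⟩, p'⟩) hpp
    · exact congrArg _ (Subsingleton.elim _ _)
    · simpa [hnil, hcons] using congrArg (Path.lastArrow Q) hpp
    · simpa [hnil, hcons] using congrArg (Path.lastArrow Q) hpp
    · obtain rfl : e = e' := Option.some.inj (congrArg (Path.lastArrow Q) hpp)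
      obtain rfl : p = p' := eq_of_heq (Quiver.Path.cons.inj hpp).2.1
      rfl
  · intro p
    cases p with
    | nil => exact ⟨Sum.inl ⟨rfl⟩, rfl⟩
    | cons p e =>
      obtain ⟨e, rfl, he⟩ := e
      exact ⟨Sum.inr ⟨⟨e, he⟩, p⟩, rfl⟩

/-- The number of vertices from which there is a path to `b`. Without oriented cycles it increases
along arrows, which makes inductions along paths possible. -/
noncomputable def depth (Q : FinQuiver V E) (b : V) : ℕ := {a | Nonempty (Q.Path a b)}.ncard

theorem NoOrientedCycles.depth_lt [Finite V] (hQ : Q.NoOrientedCycles) (e : E) :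
    Q.depth (Q.src e) < Q.depth (Q.tgt e) := by
  refine Set.ncard_lt_ncard (Set.ssubset_iff_exists.2 ⟨?_, Q.tgt e, ?_, ?_⟩) (Set.toFinite _)
  · rintro a ⟨p⟩
    exact ⟨Path.snoc Q e p⟩
  · exact ⟨@Quiver.Path.nil V Q.toQuiver _⟩
  · rintro ⟨p⟩
    exact nomatch hQ _ (Path.snoc Q e p)

theorem NoOrientedCycles.finite_path [Finite V] [Finite E] (hQ : Q.NoOrientedCycles)
    (a b : V) : Finite (Q.Path a b) := by
  induction hn : Q.depth b using Nat.strong_induction_on generalizing b with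
  | _ n ih =>
    have (e : {e : E // Q.tgt e = b}) : Finite (Q.Path a (Q.src e)) := by
      obtain ⟨e, rfl⟩ := e
      exact ih _ (hn ▸ hQ.depth_lt e) _ rfl
    exact Finite.of_surjective _ (Path.ofSum_bijective Q a b).surjective

/-- The matrix whose entry at `(a, b)` is the number of paths from `a` to `b`. -/
noncomputable def pathMatrix (Q : FinQuiver V E) : Matrix V V ℤ :=
  fun a b => (Nat.card (Q.Path a b) : ℤ)

theorem pathMatrix_apply (Q : FinQuiver V E) (a b : V) :
    Q.pathMatrix a b = Nat.card (Q.Path a b) := rfl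

section AdmissibleOrdering

variable [DecidableEq V]

theorem sinkSequence_of_pairwise_le (d : V → ℕ) (Q : FinQuiver V E) {l : List V} (hl : l.Nodup)
    (hs : l.Pairwise fun a b => d b ≤ d a)
    (h : ∀ e, Q.src e ∈ l → Q.tgt e ∈ l ∧ d (Q.src e) < d (Q.tgt e)) : Q.SinkSequence l := by
  induction l generalizing Q with
  | nil => trivial
  | cons i l ih =>
    rw [List.nodup_cons] at hl
    rw [List.pairwise_cons] at hs
    have hi : Q.IsSink i := by
      rintro e rfl
      obtain ⟨hmem, hlt⟩ := h e List.mem_cons_self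
      rcases List.mem_cons.1 hmem with heq | hmem
      · exact hlt.ne (congrArg d heq.symm)
      · exact (hs.1 _ hmem).not_gt hlt
    refine ⟨hi, ih _ hl.2 hs.2 fun e he => ?_⟩
    by_cases ht : Q.tgt e = i
    · simp only [reflect, ht, or_true, if_true] at he
      exact absurd he hl.1
    · simp only [reflect, hi e, ht, or_false, if_false] at he ⊢
      obtain ⟨hmem, hlt⟩ := h e (List.mem_cons_of_mem _ he)
      exact ⟨(List.mem_cons.1 hmem).resolve_left ht, hlt⟩

theorem NoOrientedCycles.nonempty_admissibleOrdering [Finite V] (hQ : Q.NoOrientedCycles) :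
    Nonempty Q.AdmissibleOrdering := by
  have := Fintype.ofFinite V
  let r (a b : V) : Prop := Q.depth b ≤ Q.depth a
  have : DecidableRel r := fun _ _ => Nat.decLe _ _
  have : Std.Total r := ⟨fun _ _ => le_total _ _⟩
  have : IsTrans V r := ⟨fun _ _ _ hab hbc => le_trans hbc hab⟩
  have hperm := List.perm_insertionSort r (Finset.univ : Finset V).toList
  have hmem (v : V) := hperm.mem_iff.2 (Finset.mem_toList.2 (Finset.mem_univ v))
  have hnodup := hperm.nodup_iff.2 (Finset.nodup_toList Finset.univ)
  exact ⟨⟨_, hnodup, hmem, sinkSequence_of_pairwise_le Q.depth Q hnodup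
    (List.pairwise_insertionSort r _) fun e _ => ⟨hmem _, hQ.depth_lt e⟩⟩⟩

end AdmissibleOrdering

section EulerForm

open scoped Matrix

variable [Fintype V] [Fintype E]

section Matrix

variable [DecidableEq V]

/-- The matrix whose entry at `(a, b)` is the number of arrows from `a` to `b`. -/
def arrowMatrix (Q : FinQuiver V E) : Matrix V V ℤ :=
  ∑ e, Matrix.single (Q.src e) (Q.tgt e) 1

theorem eulerForm_eq_dotProduct (Q : FinQuiver V E) (x y : V → ℤ) :
    Q.eulerForm x y = x ⬝ᵥ (1 - Q.arrowMatrix) *ᵥ y := by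
  rw [Matrix.sub_mulVec, dotProduct_sub, Matrix.one_mulVec, eulerForm, arrowMatrix,
    Matrix.sum_mulVec, dotProduct_sum]
  congr 1
  refine Finset.sum_congr rfl fun e _ => ?_
  simp [Matrix.single_mulVec, dotProduct, Function.update_apply]

theorem mul_arrowMatrix_apply (Q : FinQuiver V E) (M : Matrix V V ℤ) (a b : V) :
    (M * Q.arrowMatrix) a b = ∑ e : {e : E // Q.tgt e = b}, M a (Q.src e) := by
  rw [← Finset.sum_subtype (Finset.univ.filter fun e => Q.tgt e = b) (by simp)
    fun e => M a (Q.src e), Finset.sum_filter, arrowMatrix, Matrix.mul_sum, Matrix.sum_apply]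
  refine Finset.sum_congr rfl fun e _ => ?_
  by_cases h : Q.tgt e = b
  · subst h
    simp
  · rw [if_neg h, Matrix.mul_single_apply_of_ne _ _ _ _ _ (Ne.symm h)]

theorem NoOrientedCycles.pathMatrix_mul_one_sub (hQ : Q.NoOrientedCycles) :
    Q.pathMatrix * (1 - Q.arrowMatrix) = 1 := by
  rw [mul_sub, mul_one, sub_eq_iff_eq_add]
  ext a b
  have := hQ.finite_path
  have htrivial : (Nat.card (PLift (a = b)) : ℤ) = (1 : Matrix V V ℤ) a b := by
    rw [Nat.card_eq_fintype_card, Matrix.one_apply]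
    split_ifs with h <;> simp [h]
  rw [Matrix.add_apply, ← htrivial, mul_arrowMatrix_apply, pathMatrix_apply,
    ← Nat.card_congr (Equiv.ofBijective _ (Path.ofSum_bijective Q a b)), Nat.card_sum,
    Nat.card_sigma]
  push_cast
  rfl

end Matrix

theorem NoOrientedCycles.eulerForm_row (hQ : Q.NoOrientedCycles) (i : V) (y : V → ℤ) :
    Q.eulerForm (Q.pathMatrix.row i) y = y i := by
  classical
  have hrow : Q.pathMatrix.row i ᵥ* (1 - Q.arrowMatrix) = Pi.single i 1 := by
    rw [← Matrix.single_one_vecMul, Matrix.vecMul_vecMul, hQ.pathMatrix_mul_one_sub,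
      Matrix.vecMul_one]
  rw [eulerForm_eq_dotProduct, Matrix.dotProduct_mulVec, hrow, single_one_dotProduct]

theorem NoOrientedCycles.eulerForm_col (hQ : Q.NoOrientedCycles) (i : V) (y : V → ℤ) :
    Q.eulerForm y (Q.pathMatrix.col i) = y i := by
  classical
  have hcol : (1 - Q.arrowMatrix) *ᵥ Q.pathMatrix.col i = Pi.single i 1 := by
    rw [← Matrix.mulVec_single_one, Matrix.mulVec_mulVec,
      mul_eq_one_comm.1 hQ.pathMatrix_mul_one_sub, Matrix.one_mulVec]
  rw [eulerForm_eq_dotProduct, hcol, dotProduct_single_one]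

theorem NoOrientedCycles.dualFamilies (hQ : Q.NoOrientedCycles) :
    Q.DualFamilies Q.pathMatrix.row Q.pathMatrix.col where
  eulerForm_p := hQ.eulerForm_row
  eulerForm_h := hQ.eulerForm_col
  p_nonneg _ _ := Nat.cast_nonneg _
  h_nonneg _ _ := Nat.cast_nonneg _

end EulerForm

end FinQuiver

namespace QuiverRep

variable {V E : Type} {k : Type u} [Field k] {Q : FinQuiver V E}

section Criteria

variable {X : QuiverRep k Q} {i : V}

theorem bot_top_or_top_bot_of_isCompl (hi : Module.finrank k (X.obj i) = 1)
    {U W : Submodule k (X.obj i)} (hUW : IsCompl U W) :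
    U = ⊥ ∧ W = ⊤ ∨ U = ⊤ ∧ W = ⊥ := by
  have : IsSimpleOrder (Submodule k (X.obj i)) :=
    (isSimpleModule_iff k _).1 (isSimpleModule_iff_finrank_eq_one.2 hi)
  rcases eq_bot_or_eq_top U with rfl | rfl
  · exact Or.inl ⟨rfl, eq_top_of_bot_isCompl hUW⟩
  · exact Or.inr ⟨rfl, eq_bot_of_top_isCompl hUW⟩

theorem indecomposable_of_isSubrep_eq_top (hi : Module.finrank k (X.obj i) = 1)
    (h : ∀ U, X.IsSubrep U → U i = ⊤ → ∀ j, U j = ⊤) : X.Indecomposable := by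
  refine ⟨⟨i, Module.nontrivial_of_finrank_pos (R := k) (by omega)⟩, fun U W hU hW hUW => ?_⟩
  rcases bot_top_or_top_bot_of_isCompl hi (hUW i) with ⟨-, hWi⟩ | ⟨hUi, -⟩
  · exact Or.inl fun j => eq_bot_of_isCompl_top (h W hW hWi j ▸ hUW j)
  · exact Or.inr fun j => eq_bot_of_top_isCompl (h U hU hUi j ▸ hUW j)

theorem indecomposable_of_isSubrep_eq_bot (hi : Module.finrank k (X.obj i) = 1)
    (h : ∀ U, X.IsSubrep U → U i = ⊥ → ∀ j, U j = ⊥) : X.Indecomposable := by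
  refine ⟨⟨i, Module.nontrivial_of_finrank_pos (R := k) (by omega)⟩, fun U W hU hW hUW => ?_⟩
  rcases bot_top_or_top_bot_of_isCompl hi (hUW i) with ⟨hUi, -⟩ | ⟨-, hWi⟩
  · exact Or.inl (h U hU hUi)
  · exact Or.inr (h W hW hWi)

end Criteria

section Projective

theorem IsSubrep.single_path_mem {i : V} {U : ∀ j, Submodule k ((proj k Q i).obj j)}
    (hU : (proj k Q i).IsSubrep U)
    (h : Finsupp.single (@Quiver.Path.nil V Q.toQuiver i) (1 : k) ∈ U i) {j : V}
    (p : Q.Path i j) : Finsupp.single p (1 : k) ∈ U j := by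
  induction p with
  | nil => exact h
  | cons p e ih =>
    obtain ⟨e, rfl, rfl⟩ := e
    have hmap : (proj k Q i).map e (Finsupp.single p 1) =
        Finsupp.single (FinQuiver.Path.snoc Q e p) (1 : k) := Finsupp.mapDomain_single
    exact hmap ▸ hU e _ ih

theorem IsSubrep.proj_eq_top {i : V} {U : ∀ j, Submodule k ((proj k Q i).obj j)}
    (hU : (proj k Q i).IsSubrep U) (h : U i = ⊤) (j : V) : U j = ⊤ := by
  refine top_unique ((Finsupp.basisSingleOne (R := k) (ι := Q.Path i j)).span_eq.ge.trans
    (Submodule.span_le.2 ?_))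
  rintro _ ⟨p, rfl⟩
  rw [Finsupp.coe_basisSingleOne]
  exact hU.single_path_mem (Submodule.eq_top_iff'.1 h _) p

theorem finrank_proj (hQ : ∀ a b, Finite (Q.Path a b)) (i j : V) :
    Module.finrank k ((proj k Q i).obj j) = Nat.card (Q.Path i j) := by
  have := Fintype.ofFinite (Q.Path i j)
  rw [Nat.card_eq_fintype_card]
  exact Module.finrank_finsupp_self k

theorem isIndecOfDim_proj [Finite V] [Finite E] (hQ : Q.NoOrientedCycles) (i : V) :
    (proj k Q i).IsIndecOfDim (Q.pathMatrix.row i) where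
  indecomposable := by
    have : Unique (Q.Path i i) := ⟨⟨@Quiver.Path.nil V Q.toQuiver i⟩, hQ i⟩
    refine indecomposable_of_isSubrep_eq_top (i := i) ?_ fun U hU h => hU.proj_eq_top h
    rw [finrank_proj hQ.finite_path, Nat.card_unique]
  finiteDimensional j :=
    have := hQ.finite_path
    inferInstanceAs (FiniteDimensional k (Q.Path i j →₀ k))
  dimVector_eq := funext fun j => congrArg Nat.cast (finrank_proj hQ.finite_path i j)

end Projective

section Injective

/-- Precomposition with the path `p` of functionals on the paths that end at `i`: the action of `p`
on the representation `I(i)`. -/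
noncomputable def injPath (k : Type u) [Field k] (Q : FinQuiver V E) (i : V) {j m : V}
    (p : Q.Path j m) : Module.Dual k (Q.Path j i →₀ k) →ₗ[k] Module.Dual k (Q.Path m i →₀ k) :=
  (Finsupp.lmapDomain k k fun q : Q.Path m i => @Quiver.Path.comp V Q.toQuiver j m i p q).dualMap

theorem injPath_single {i j m : V} (p : Q.Path j m) (x : Module.Dual k (Q.Path j i →₀ k))
    (q : Q.Path m i) : injPath k Q i p x (Finsupp.single q 1) =
      x (Finsupp.single (@Quiver.Path.comp V Q.toQuiver j m i p q) 1) :=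
  congrArg x Finsupp.mapDomain_single

theorem injPath_nil {i j : V} (x : Module.Dual k (Q.Path j i →₀ k)) :
    injPath k Q i (@Quiver.Path.nil V Q.toQuiver j) x = x := by
  refine Finsupp.lhom_ext' fun q => LinearMap.ext_ring ?_
  refine (injPath_single _ x q).trans ?_
  rw [@Quiver.Path.nil_comp V Q.toQuiver]
  rfl

theorem injPath_snoc {i j : V} (e : E) (p : Q.Path j (Q.src e))
    (x : Module.Dual k (Q.Path j i →₀ k)) :
    injPath k Q i (FinQuiver.Path.snoc Q e p) x = (inj k Q i).map e (injPath k Q i p x) := by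
  refine Finsupp.lhom_ext' fun q => LinearMap.ext_ring ?_
  have hmap : Finsupp.mapDomain (FinQuiver.Path.precede Q e) (Finsupp.single q (1 : k)) =
      Finsupp.single (FinQuiver.Path.precede Q e q) 1 := Finsupp.mapDomain_single
  have hcomp : injPath k Q i p x (Finsupp.mapDomain (FinQuiver.Path.precede Q e)
      (Finsupp.single q 1)) = injPath k Q i (FinQuiver.Path.snoc Q e p) x (Finsupp.single q 1) := by
    rw [hmap, injPath_single, injPath_single, FinQuiver.Path.precede,
      ← @Quiver.Path.comp_assoc V Q.toQuiver]
    rfl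
  exact hcomp.symm

theorem IsSubrep.injPath_mem {i : V} {U : ∀ j, Submodule k ((inj k Q i).obj j)}
    (hU : (inj k Q i).IsSubrep U) {j m : V} (p : Q.Path j m) {x : (inj k Q i).obj j}
    (hx : x ∈ U j) : (injPath k Q i p x : (inj k Q i).obj m) ∈ U m := by
  induction p with
  | nil => exact (injPath_nil x).symm ▸ hx
  | cons p e ih =>
    obtain ⟨e, rfl, rfl⟩ := e
    exact (injPath_snoc e p x).symm ▸ hU e _ ih

theorem IsSubrep.inj_eq_bot {i : V} {U : ∀ j, Submodule k ((inj k Q i).obj j)}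
    (hU : (inj k Q i).IsSubrep U) (h : U i = ⊥) (j : V) : U j = ⊥ := by
  rw [Submodule.eq_bot_iff]
  intro x hx
  refine Finsupp.lhom_ext' fun p => LinearMap.ext_ring ?_
  have hp : injPath k Q i p x = 0 := (Submodule.eq_bot_iff _).1 h _ (hU.injPath_mem p hx)
  have := injPath_single p x (@Quiver.Path.nil V Q.toQuiver i)
  rw [@Quiver.Path.comp_nil V Q.toQuiver, hp] at this
  exact this.symm

theorem finrank_inj (hQ : ∀ a b, Finite (Q.Path a b)) (i j : V) :
    Module.finrank k ((inj k Q i).obj j) = Nat.card (Q.Path j i) :=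
  Subspace.dual_finrank_eq.trans (finrank_proj hQ j i)

theorem isIndecOfDim_inj [Finite V] [Finite E] (hQ : Q.NoOrientedCycles) (i : V) :
    (inj k Q i).IsIndecOfDim (Q.pathMatrix.col i) where
  indecomposable := by
    have : Unique (Q.Path i i) := ⟨⟨@Quiver.Path.nil V Q.toQuiver i⟩, hQ i⟩
    refine indecomposable_of_isSubrep_eq_bot (i := i) ?_ fun U hU h => hU.inj_eq_bot h
    rw [finrank_inj hQ.finite_path, Nat.card_unique]
  finiteDimensional j :=
    have := hQ.finite_path
    inferInstanceAs (FiniteDimensional k (Module.Dual k (Q.Path j i →₀ k)))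
  dimVector_eq := funext fun j => congrArg Nat.cast (finrank_inj hQ.finite_path i j)

end Injective

end QuiverRep

/-! ### Euclidean diagrams -/

namespace EuclideanDiagram

/-- The contribution of an edge to the sum of the marks of the neighbours of the vertex `v`, to
which a loop contributes twice. -/
def edgeMark (T : EuclideanDiagram) (v : ℕ) : Sym2 ℕ → ℤ :=
  Sym2.lift ⟨fun a b => (if a = v then T.delta b else 0) + if b = v then T.delta a else 0,
    fun _ _ => add_comm _ _⟩

theorem edgeMark_mk (T : EuclideanDiagram) (v a b : ℕ) :
    T.edgeMark v s(a, b) = (if a = v then T.delta b else 0) + if b = v then T.delta a else 0 :=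
  rfl

theorem delta_pos (T : EuclideanDiagram) {v : ℕ} (hv : v < T.card) : 0 < T.delta v := by
  cases T with
  | A m => exact one_pos
  | D m hm => simp only [delta]; split_ifs <;> norm_num
  | E6 => simp only [card] at hv; interval_cases v <;> decide
  | E7 => simp only [card] at hv; interval_cases v <;> decide
  | E8 => simp only [card] at hv; interval_cases v <;> decide

theorem sum_edgeMark_A (m : ℕ) {v : ℕ} (hv : v < m + 1) :
    ((A m).edges.map fun p => (A m).edgeMark v s(p.1, p.2)).sum = 2 * (A m).delta v := by
  have hsrc : ∑ i ∈ Finset.range (m + 1), (if i = v then (1 : ℤ) else 0) = 1 := by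
    rw [Finset.sum_ite_eq', if_pos (Finset.mem_range.2 hv)]
  have htgt : ∑ i ∈ Finset.range (m + 1), (if (i + 1) % (m + 1) = v then (1 : ℤ) else 0) = 1 := by
    refine Eq.trans ?_ hsrc
    rw [Finset.sum_range_succ, Finset.sum_range_succ', Nat.mod_self]
    congr 1
    refine Finset.sum_congr rfl fun i hi => ?_
    rw [Nat.mod_eq_of_lt (Nat.succ_lt_succ (Finset.mem_range.1 hi))]
  simp only [edges, List.map_map, Function.comp_def, edgeMark_mk, delta]
  rw [← List.sum_toFinset _ List.nodup_range, List.toFinset_range, Finset.sum_add_distrib, hsrc,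
    htgt]
  norm_num

theorem sum_edgeMark_D (m : ℕ) (hm : 4 ≤ m) {v : ℕ} (hv : v < m + 1) :
    ((D m hm).edges.map fun p => (D m hm).edgeMark v s(p.1, p.2)).sum =
      2 * (D m hm).delta v := by
  obtain ⟨n, rfl⟩ := Nat.exists_eq_add_of_le' hm
  have hite (N c v : ℕ) (g : ℕ → ℤ) :
      (∑ i ∈ Finset.range N, if i + c = v + c then g i else 0) = if v < N then g v else 0 := by
    simp only [Nat.add_right_cancel_iff, Finset.sum_ite_eq', Finset.mem_range]
  simp only [edges, List.map_cons, List.map_map, Function.comp_def, edgeMark_mk, List.sum_cons]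
  rw [← List.sum_toFinset _ List.nodup_range, List.toFinset_range, Finset.sum_add_distrib]
  rcases v with _ | _ | v
  · simp [delta]
  · simp [delta]
  · have hright := hite (n + 2) 1 (v + 1) fun i => (D (n + 4) hm).delta (i + 2)
    have hleft := hite (n + 2) 2 v fun i => (D (n + 4) hm).delta (i + 1)
    simp only [show n + 4 - 2 = n + 2 by omega]
    rw [hright, hleft]
    simp only [delta]
    have hcases : v < n ∨ v = n ∨ v = n + 1 ∨ v = n + 2 := by omega
    rcases hcases with h | h | h | h
    all_goals grind

theorem sum_edgeMark (T : EuclideanDiagram) {v : ℕ} (hv : v < T.card) :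
    (T.edges.map fun p => T.edgeMark v s(p.1, p.2)).sum = 2 * T.delta v := by
  cases T with
  | A m => exact sum_edgeMark_A m hv
  | D m hm => exact sum_edgeMark_D m hm hv
  | E6 => simp only [card] at hv; interval_cases v <;> decide
  | E7 => simp only [card] at hv; interval_cases v <;> decide
  | E8 => simp only [card] at hv; interval_cases v <;> decide

theorem connected_A (m : ℕ) {P : ℕ → Prop} (hP : ∀ p ∈ (A m).edges, P p.1 ↔ P p.2)
    {v : ℕ} (hv : v < m + 1) : P v ↔ P 0 := by
  induction v with
  | zero => rfl
  | succ v ih =>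
    have hmem : (v, (v + 1) % (m + 1)) ∈ (A m).edges :=
      List.mem_map.2 ⟨v, List.mem_range.2 (by omega), rfl⟩
    have hstep := hP _ hmem
    rw [Nat.mod_eq_of_lt hv] at hstep
    exact hstep.symm.trans (ih (by omega))

theorem connected_D (m : ℕ) (hm : 4 ≤ m) {P : ℕ → Prop}
    (hP : ∀ p ∈ (D m hm).edges, P p.1 ↔ P p.2) {v : ℕ} (hv : v < m + 1) : P v ↔ P 0 := by
  simp only [edges, List.forall_mem_cons] at hP
  obtain ⟨hfirst, hlast, hpath⟩ := hP
  have hstep (j : ℕ) (hj : j < m - 2) : P (j + 1) ↔ P (j + 2) :=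
    hpath (j + 1, j + 2) (List.mem_map.2 ⟨j, List.mem_range.2 hj, rfl⟩)
  have hinner (j : ℕ) (hj : j < m - 1) : P (j + 1) ↔ P 0 := by
    induction j with
    | zero => exact (hstep 0 (by omega)).trans hfirst.symm
    | succ j ih => exact (hstep j (by omega)).symm.trans (ih (by omega))
  rcases Nat.eq_zero_or_pos v with rfl | hpos
  · rfl
  obtain ⟨j, rfl⟩ := Nat.exists_eq_add_of_le' hpos
  rcases Nat.lt_or_ge j (m - 1) with hj | hj
  · exact hinner j hj
  · rw [show j + 1 = m by omega, ← hlast, show m - 2 = m - 3 + 1 by omega]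
    exact hinner (m - 3) (by omega)

theorem connected (T : EuclideanDiagram) {P : ℕ → Prop} (hP : ∀ p ∈ T.edges, P p.1 ↔ P p.2)
    {v : ℕ} (hv : v < T.card) : P v ↔ P 0 := by
  cases T with
  | A m => exact connected_A m hP hv
  | D m hm => exact connected_D m hm hP hv
  | E6 | E7 | E8 =>
    simp only [edges, List.forall_mem_cons] at hP
    simp only [card] at hv
    interval_cases v <;> grind

end EuclideanDiagram

namespace FinQuiver

namespace HasDiagram

variable {V E : Type} [Fintype E] {Q : FinQuiver V E} {T : EuclideanDiagram} {f : V ≃ Fin T.card}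

theorem sum_edges (hf : Q.HasDiagram T f) (F : Sym2 ℕ → ℤ) :
    ∑ e, F s((f (Q.src e) : ℕ), (f (Q.tgt e) : ℕ)) = (T.edges.map fun p => F s(p.1, p.2)).sum := by
  have h := congrArg (fun s => (s.map F).sum) hf
  simp only [Multiset.map_map, Multiset.map_coe, Multiset.sum_coe, List.map_map] at h
  exact h

theorem exists_arrow (hf : Q.HasDiagram T f) {p : ℕ × ℕ} (hp : p ∈ T.edges) :
    ∃ e, s((f (Q.src e) : ℕ), (f (Q.tgt e) : ℕ)) = s(p.1, p.2) := by
  have hmem : s(p.1, p.2) ∈ ((T.edges.map fun p => s(p.1, p.2) : List (Sym2 ℕ)) :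
      Multiset (Sym2 ℕ)) := Multiset.mem_coe.2 (List.mem_map.2 ⟨p, hp, rfl⟩)
  rw [← hf] at hmem
  obtain ⟨e, -, he⟩ := Multiset.mem_map.1 hmem
  exact ⟨e, he⟩

theorem iff_of_forall_arrow (hf : Q.HasDiagram T f) {P : V → Prop}
    (hP : ∀ e, P (Q.src e) ↔ P (Q.tgt e)) (i j : V) : P i ↔ P j := by
  let P' (n : ℕ) : Prop := ∃ h : n < T.card, P (f.symm ⟨n, h⟩)
  have hP' (v : V) : P' (f v) ↔ P v := by simp [P']
  have hedges (p : ℕ × ℕ) (hp : p ∈ T.edges) : P' p.1 ↔ P' p.2 := by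
    obtain ⟨e, he⟩ := hf.exists_arrow hp
    rcases Sym2.eq_iff.1 he with ⟨hsrc, htgt⟩ | ⟨hsrc, htgt⟩
    · rw [← hsrc, ← htgt, hP', hP', hP e]
    · rw [← hsrc, ← htgt, hP', hP', hP e]
  rw [← hP' i, ← hP' j, T.connected hedges (f i).2, T.connected hedges (f j).2]

theorem isEuclidean [Fintype V] (hf : Q.HasDiagram T f) :
    Q.IsEuclidean fun i => T.delta (f i : ℕ) where
  pos i := T.delta_pos (f i).2
  radical := by
    classical
    refine (Pi.basisFun ℤ V).ext fun i => ?_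
    rw [Pi.basisFun_apply, symmForm_comm, symmForm_single, LinearMap.zero_apply, sub_eq_zero,
      ← T.sum_edgeMark (f i).2, ← hf.sum_edges]
    simp only [EuclideanDiagram.edgeMark_mk, Fin.val_inj, f.apply_eq_iff_eq]
  connected _ hP i j := (hf.iff_of_forall_arrow hP i j).1

end HasDiagram

end FinQuiver

/-! ### The preprojective and preinjective series -/

namespace FinQuiver.AdmissibleOrdering

variable {V E : Type} [Fintype V] [DecidableEq V] [Fintype E] {Q : FinQuiver V E}

/-- The dimension vectors of the members of the series `C^{-r} P(i)` (left copy of `V`) and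
`C^r I(i)` (right copy): the orbits of the dimension vectors of `P(i)` and `I(i)` under the
Coxeter transformation. -/
noncomputable def seriesDim (o : Q.AdmissibleOrdering) : V ⊕ V → ℕ → V → ℤ
  | Sum.inl i, r => (o.op.coxeter ^ r) (Q.pathMatrix.row i)
  | Sum.inr i, r => (o.coxeter ^ r) (Q.pathMatrix.col i)

theorem op_op_coxeter (o : Q.AdmissibleOrdering) : o.op.op.coxeter = o.coxeter := by
  rw [coxeter, coxeter, reflectionList_op, reflectionList_op]
  exact congrArg Q.reflectionList (List.reverse_reverse o.list)

variable {δ : V → ℤ} (o : Q.AdmissibleOrdering)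

theorem isPosRoot_seriesDim (hQ : Q.NoOrientedCycles) (hδ : Q.IsEuclidean δ) (p : V ⊕ V)
    (r : ℕ) : Q.IsPosRoot (o.seriesDim p r) := by
  rcases p with i | i
  · exact Q.isPosRoot_op ▸ hQ.dualFamilies.op.isPosRoot_coxeter_pow_h o.op hδ.op r i
  · exact hQ.dualFamilies.isPosRoot_coxeter_pow_h o hδ r i

theorem defect_seriesDim (hQ : Q.NoOrientedCycles) (hδ : Q.IsEuclidean δ) (p : V ⊕ V) (r : ℕ) :
    Q.eulerForm δ (o.seriesDim p r) = Sum.elim (-δ) δ p := by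
  rcases p with i | i
  · have hop := hQ.dualFamilies.op.defect_coxeter_pow_h o.op hδ.op r i
    rw [eulerForm_op, hδ.eulerForm_swap] at hop
    exact neg_eq_iff_eq_neg.1 hop
  · exact hQ.dualFamilies.defect_coxeter_pow_h o hδ r i

theorem seriesDim_injective (hQ : Q.NoOrientedCycles) (hδ : Q.IsEuclidean δ) :
    Function.Injective fun a : (V ⊕ V) × ℕ => o.seriesDim a.1 a.2 := by
  rintro ⟨p, r⟩ ⟨p', r'⟩ h
  have hdefect := congrArg (Q.eulerForm δ) h
  simp only [o.defect_seriesDim hQ hδ] at hdefect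
  rcases p with i | i <;> rcases p' with j | j <;>
    simp only [Sum.elim_inl, Sum.elim_inr, Pi.neg_apply] at hdefect
  · have hir := hQ.dualFamilies.op.coxeter_pow_h_injective o.op hδ.op (a₁ := (i, r))
      (a₂ := (j, r')) h
    simpa using hir
  · linarith [hδ.pos i, hδ.pos j]
  · linarith [hδ.pos i, hδ.pos j]
  · have hir := hQ.dualFamilies.coxeter_pow_h_injective o hδ (a₁ := (i, r)) (a₂ := (j, r')) h
    simpa using hir

theorem exists_seriesDim_eq (hQ : Q.NoOrientedCycles) (hδ : Q.IsEuclidean δ) {x : V → ℤ}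
    (hx : Q.IsPosRoot x) (hd : Q.eulerForm δ x ≠ 0) : ∃ p r, o.seriesDim p r = x := by
  rcases hd.lt_or_gt with hneg | hpos
  · obtain ⟨i, r, hir⟩ := hQ.dualFamilies.exists_eq_coxeter_pow_p o hδ hx hneg
    exact ⟨Sum.inl i, r, hir⟩
  · have hneg : Q.op.eulerForm δ x < 0 := by
      rw [eulerForm_op, hδ.eulerForm_swap]
      exact neg_neg_of_pos hpos
    obtain ⟨i, r, hir⟩ :=
      hQ.dualFamilies.op.exists_eq_coxeter_pow_p o.op hδ.op (Q.isPosRoot_op ▸ hx) hneg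
    rw [op_op_coxeter] at hir
    exact ⟨Sum.inr i, r, hir⟩

theorem range_seriesDim (hQ : Q.NoOrientedCycles) (hδ : Q.IsEuclidean δ) :
    Set.range (fun a : (V ⊕ V) × ℕ => o.seriesDim a.1 a.2) =
      {x | Q.IsRoot x ∧ 0 < x ∧ Q.eulerForm δ x ≠ 0} := by
  ext x
  constructor
  · rintro ⟨⟨p, r⟩, rfl⟩
    obtain ⟨hroot, hpos⟩ := o.isPosRoot_seriesDim hQ hδ p r
    refine ⟨hroot, hpos, ?_⟩
    rw [o.defect_seriesDim hQ hδ]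
    rcases p with i | i
    · exact neg_ne_zero.2 (hδ.pos i).ne'
    · exact (hδ.pos i).ne'
  · rintro ⟨hroot, hpos, hd⟩
    obtain ⟨p, r, rfl⟩ := o.exists_seriesDim_eq hQ hδ ⟨hroot, hpos⟩ hd
    exact ⟨(p, r), rfl⟩

end FinQuiver.AdmissibleOrdering

namespace QuiverRep

variable {V E : Type} {k : Type u} [Field k] {Q : FinQuiver V E} {δ : V → ℤ}

theorem IsIsomorphic.dimVector_eq {X Y : QuiverRep k Q} (h : X.IsIsomorphic Y) :
    X.dimVector = Y.dimVector :=
  congrArg IsoClass.dimVector (Quotient.sound h : X.isoClass = Y.isoClass)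

section Series

variable [DecidableEq V] [Fintype E] [DecidableEq E] (o : Q.AdmissibleOrdering)

theorem coxPow_neg_natCast (r : ℕ) (X : QuiverRep k Q) :
    coxPow o (-(r : ℤ)) X = (coxMinus o)^[r] X := by
  cases r <;> rfl

variable {o} in
theorem exists_isIsomorphic_series {X : QuiverRep k Q}
    (hX : IsPreprojective o X ∨ IsPreinjective o X) :
    ∃ p r, X.IsIsomorphic (series k o p r) := by
  rcases hX with ⟨-, i, r, hr, h⟩ | ⟨-, i, r, hr, h⟩
  · refine ⟨Sum.inl i, r.natAbs, ?_⟩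
    rwa [series, Int.ofNat_natAbs_of_nonpos hr, neg_neg]
  · refine ⟨Sum.inr i, r.natAbs, ?_⟩
    rwa [series, Int.natAbs_of_nonneg hr]

variable [Fintype V]

theorem isIndecOfDim_series (hQ : Q.NoOrientedCycles) (hδ : Q.IsEuclidean δ) (p : V ⊕ V)
    (r : ℕ) : (series k o p r).IsIndecOfDim (o.seriesDim p r) := by
  rcases p with i | i
  · rw [series, coxPow_neg_natCast]
    exact (isIndecOfDim_proj hQ i).iterate_coxMinus
      (fun r => hQ.dualFamilies.op.avoidsSimple_coxeter_pow_h o.op hδ.op r i) r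
  · exact (isIndecOfDim_inj hQ i).iterate_coxPlus
      (fun r => hQ.dualFamilies.avoidsSimple_coxeter_pow_h o hδ r i) r

theorem isPreprojective_series (hQ : Q.NoOrientedCycles) (hδ : Q.IsEuclidean δ) (i : V) (r : ℕ) :
    IsPreprojective o (series k o (Sum.inl i) r) :=
  ⟨(isIndecOfDim_series o hQ hδ _ r).indecomposable, i, -(r : ℤ), by simp,
    isIsomorphic_equivalence.refl _⟩

theorem isPreinjective_series (hQ : Q.NoOrientedCycles) (hδ : Q.IsEuclidean δ) (i : V) (r : ℕ) :
    IsPreinjective o (series k o (Sum.inr i) r) :=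
  ⟨(isIndecOfDim_series o hQ hδ _ r).indecomposable, i, (r : ℤ), by simp,
    isIsomorphic_equivalence.refl _⟩

theorem eq_of_isIsomorphic_series (hQ : Q.NoOrientedCycles) (hδ : Q.IsEuclidean δ)
    {p p' : V ⊕ V} {r r' : ℕ} (h : (series k o p r).IsIsomorphic (series k o p' r')) :
    p = p' ∧ r = r' := by
  have hdim := h.dimVector_eq
  rw [(isIndecOfDim_series o hQ hδ p r).dimVector_eq,
    (isIndecOfDim_series o hQ hδ p' r').dimVector_eq] at hdim
  exact Prod.mk.inj (o.seriesDim_injective hQ hδ (a₁ := (p, r)) (a₂ := (p', r')) hdim)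

theorem preprojPreinjClasses_eq_range (hQ : Q.NoOrientedCycles) (hδ : Q.IsEuclidean δ) :
    preprojPreinjClasses k o =
      Set.range fun a : (V ⊕ V) × ℕ => (series k o a.1 a.2).isoClass := by
  ext c
  constructor
  · rintro ⟨X, rfl, -, hX⟩
    obtain ⟨p, r, h⟩ := exists_isIsomorphic_series hX
    exact ⟨(p, r), (Quotient.sound h).symm⟩
  · rintro ⟨⟨p, r⟩, rfl⟩
    refine ⟨_, rfl, (isIndecOfDim_series o hQ hδ p r).finiteDimensional, ?_⟩
    rcases p with i | i
    · exact Or.inl (isPreprojective_series o hQ hδ i r)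
    · exact Or.inr (isPreinjective_series o hQ hδ i r)

theorem bijOn_dimVector_preprojPreinjClasses (hQ : Q.NoOrientedCycles) (hδ : Q.IsEuclidean δ) :
    Set.BijOn IsoClass.dimVector (preprojPreinjClasses k o)
      {x | Q.IsRoot x ∧ 0 < x ∧ Q.eulerForm δ x ≠ 0} := by
  have hdim : (IsoClass.dimVector ∘ fun a : (V ⊕ V) × ℕ => (series k o a.1 a.2).isoClass) =
      fun a => o.seriesDim a.1 a.2 :=
    funext fun a => (isIndecOfDim_series o hQ hδ a.1 a.2).dimVector_eq
  rw [preprojPreinjClasses_eq_range o hQ hδ, ← o.range_seriesDim hQ hδ, ← hdim, Set.range_comp]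
  exact (hdim ▸ o.seriesDim_injective hQ hδ).injOn_range.bijOn_image

end Series

end QuiverRep

theorem mainTheorem3 {k : Type u} [Field k] {V E : Type} [Fintype V] [DecidableEq V]
    [Fintype E] [DecidableEq E] (Q : FinQuiver V E) (hQ : Q.NoOrientedCycles)
    (T : EuclideanDiagram) (f : V ≃ Fin T.card) (hf : Q.HasDiagram T f) :
    -- admissible orderings exist, and for each of them the following holds
    Nonempty Q.AdmissibleOrdering ∧
    ∀ o : Q.AdmissibleOrdering,
      -- dimension vectors: a bijection onto the positive roots of non-zero defect
      Set.BijOn QuiverRep.IsoClass.dimVector (QuiverRep.preprojPreinjClasses k o)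
        {x : V → ℤ | Q.IsRoot x ∧ 0 < x ∧ Q.defect T f x ≠ 0} ∧
      -- there are `2n` series, each member of which is finite dimensional and
      -- an indecomposable preprojective, respectively preinjective, representation
      Fintype.card (V ⊕ V) = 2 * T.card ∧
      (∀ (p : V ⊕ V) (r : ℕ), (QuiverRep.series k o p r).IsFiniteDimensional) ∧
      (∀ (i : V) (r : ℕ),
        QuiverRep.IsPreprojective o (QuiverRep.series k o (Sum.inl i) r)) ∧
      (∀ (i : V) (r : ℕ),
        QuiverRep.IsPreinjective o (QuiverRep.series k o (Sum.inr i) r)) ∧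
      -- the members of the series are pairwise non-isomorphic
      (∀ (p p' : V ⊕ V) (r r' : ℕ),
        (QuiverRep.series k o p r).IsIsomorphic (QuiverRep.series k o p' r') →
          p = p' ∧ r = r') ∧
      -- every indecomposable preprojective or preinjective representation occurs
      (∀ X : QuiverRep k Q, QuiverRep.IsPreprojective o X ∨ QuiverRep.IsPreinjective o X →
        ∃ (p : V ⊕ V) (r : ℕ), X.IsIsomorphic (QuiverRep.series k o p r)) := by
  have hδ := hf.isEuclidean
  exact ⟨hQ.nonempty_admissibleOrdering, fun o =>
    ⟨QuiverRep.bijOn_dimVector_preprojPreinjClasses o hQ hδ,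
      by rw [Fintype.card_sum, Fintype.card_congr f, Fintype.card_fin, two_mul],
      fun p r => (QuiverRep.isIndecOfDim_series o hQ hδ p r).finiteDimensional,
      QuiverRep.isPreprojective_series o hQ hδ,
      QuiverRep.isPreinjective_series o hQ hδ,
      fun _ _ _ _ => QuiverRep.eq_of_isIsomorphic_series o hQ hδ,
      fun _ => QuiverRep.exists_isIsomorphic_series⟩⟩
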